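/- **Conventions.** Let $X\in\{B,C,D\}$, let $N\ge 2$ for $X=B,C$ and $N\ge 3$ for $X=D$. Weights of rank $n$ are written $\lambda=(\lambda_{\bar n},\dots,\lambda_{\bar 1})$ in coordinates on an orthonormal basis $\varepsilon_{\bar n},\dots,\varepsilon_{\bar 1}$. The positive roots of $X_n$ are $\varepsilon_{\bar i}\pm\varepsilon_{\bar j}$ ($1\le j<i\le n$), together with $\varepsilon_{\bar i}$ for type $B$, and with $2\varepsilon_{\bar i}$ for type $C$ ($1\le i\le n$); $\rho$ is half their sum and $W$ is the Weyl group, with length function $l$. The dominant weights (generalized partitions) are the $\lambda$ with $\lambda_{\bar n}\ge\dots\ge\lambda_{\bar 1}$ and: for $B$, $\lambda_{\bar1}\ge0$ and the parts are all in $\mathbb Z$ or all in $\frac12+\mathbb Z$; for $C$, all parts are in $\mathbb Z_{\ge0}$; for $D$, $\lambda_{\bar2}\ge|\lambda_{\bar1}|$ and the parts are all in $\mathbb Z$ or all in $\frac12+\mathbb Z$. For dominant $\lambda,\mu$ the Kostka–Foulkes polynomial is $$K^{X_n}_{\lambda,\mu}(q)=\sum_{\sigma\in W}(-1)^{l(\sigma)}\,\mathcal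 P_q\big(\sigma(\lambda+\rho)-(\mu+\rho)\big),\qquad \prod_{\alpha>0}\frac1{1-qx^\alpha}=\sum_\beta\mathcal P_q(\beta)x^\beta .$$ For a dominant weight $\gamma$ and an integer $r\ge0$ let $b^\lambda_{\gamma,r}$, $c^\lambda_{\gamma,r}$, $d^\lambda_{\gamma,r}$ (types $B,C,D$) be the multiplicity of the irreducible module $V(\lambda)$ in $V(\gamma)\otimes V(r\varepsilon_{\bar n})$, and let $(\gamma\otimes r)_{X_n}$ be the (finite) set of dominant $\lambda$ for which it is non-zero. Let $\nu,\mu$ be dominant weights of $X_N$ and $\mu'=(\mu_{\overline{N-1}},\dots,\mu_{\bar1})$. For $1\le k\le N$ set $$R_k=\nu_{\bar k}+k-\mu_{\bar N}-N,\qquad \gamma_k=(\nu_{\bar N}+1,\dots,\nu_{\overline{k+1}}+1,\nu_{\overline{k-1}},\dots,\nu_{\bar1}),$$ except that for $X=D$ and $\nu_{\bar1}<0$ one sets instead, for $k=1$, $$R_1=-\nu_{\bar1}+1-\mu_{\bar N}-N,\qquad \gamma_1=(\nu_{\bar N}+1,\dots,\nu_{\bar3}+1,-(\nu_{\bar2}+1)).$$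 Let $p$ be the least $k\in\{1,\dots,N\}$ with $R_k\ge0$. **Theorem 3.3.** If $p$ exists, then, with $r,m$ ranging over non-negative integers, (i) $\displaystyle K^{B_N}_{\nu,\mu}(q)=\sum_{k=p}^{N}(-1)^{N-k}q^{R_k}\sum_{r+2m=R_k}\ \sum_{\lambda\in(\gamma_k\otimes r)_{B_{N-1}}}b^{\lambda}_{\gamma_k,r}\,K^{B_{N-1}}_{\lambda,\mu'}(q),$ (ii) $\displaystyle K^{C_N}_{\nu,\mu}(q)=\sum_{k=p}^{N}(-1)^{N-k}\sum_{r+2m=R_k}\ \sum_{\lambda\in(\gamma_k\otimes r)_{C_{N-1}}}q^{R_k-m}\,c^{\lambda}_{\gamma_k,r}\,K^{C_{N-1}}_{\lambda,\mu'}(q),$ (iii) $\displaystyle K^{D_N}_{\nu,\mu}(q)=\sum_{k=p}^{N}(-1)^{N-k}q^{R_k}\sum_{r+2m=R_k}\ \sum_{\lambda\in(\gamma_k\otimes r)_{D_{N-1}}}d^{\lambda}_{\gamma_k,r}\,K^{D_{N-1}}_{\lambda,\mu'}(q),$ where a summand with $R_k\notin\mathbb Z$ is $0$ (its sum over $r+2m=R_k$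 is empty). If no such $p$ exists, then $K^{X_N}_{\nu,\mu}(q)=0$. -/

import Mathlib

namespace ClassicalRoot

/-- The three series of orthogonal and symplectic root systems
(`so (2n+1)`, `sp (2n)`, `so (2n)` in rank `n`). -/
inductive ClassicalType
  | B
  | C
  | D

/-- Weights of rank `n`, by their coordinates on the orthonormal basis `ε_1̄, …, ε_n̄`.
The coordinate on `ε_ī` (`1 ≤ i ≤ n`) is stored at the index `i - 1 : Fin n`, so the largest part
of a generalized partition comes last.  Rational coordinates make room for the half-integral
(spin) weights; the relevant weights are cut out by `IsDominant`. -/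
abbrev Weight (n : ℕ) : Type := Fin n → ℚ

/-- The basis vector `ε`. -/
def basisVec {n : ℕ} (i : Fin n) : Weight n := Pi.single i 1

/-- The simple roots. -/
def simpleRoots (X : ClassicalType) (n : ℕ) : Set (Weight n) :=
  {α | ∃ i j : Fin n, j.val = i.val + 1 ∧ α = basisVec j - basisVec i} ∪
  match X with
  | .B => {α | ∃ i : Fin n, i.val = 0 ∧ α = basisVec i}
  | .C => {α | ∃ i : Fin n, i.val = 0 ∧ α = (2 : ℚ) • basisVec i}
  | .D => {α | ∃ i j : Fin n, i.val = 0 ∧ j.val = 1 ∧ α = basisVec i + basisVec j}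

/-- The positive roots. -/
def positiveRoots (X : ClassicalType) (n : ℕ) : Finset (Weight n) :=
  ((Finset.univ.filter fun p : Fin n × Fin n => p.2 < p.1).image
      fun p => basisVec p.1 - basisVec p.2) ∪
  ((Finset.univ.filter fun p : Fin n × Fin n => p.2 < p.1).image
      fun p => basisVec p.1 + basisVec p.2) ∪
  match X with
  | .B => Finset.univ.image fun i : Fin n => basisVec i
  | .C => Finset.univ.image fun i : Fin n => (2 : ℚ) • basisVec i
  | .D => ∅

/-- The half sum of the positive roots. -/
def rho (X : ClassicalType) (n : ℕ) : Weight n :=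
  (1 / 2 : ℚ) • ∑ α ∈ positiveRoots X n, α

/-- The pairing of the weight `β` with the coroot of `α`. -/
def corootPairing {n : ℕ} (β α : Weight n) : ℚ := 2 * (β ⬝ᵥ α) / (α ⬝ᵥ α)

/-- Dominant weights (the cone `P⁺`): nonnegative integral combinations of the fundamental
weights, i.e. weights pairing to a nonnegative integer with every simple coroot. Such a weight is
the same as a generalized partition `λ_n̄ ≥ ⋯ ≥ λ_1̄`:
in type `B` all parts lie in `ℕ` or all lie in `1/2 + ℕ`; in type `C` all parts lie in `ℕ`;
in type `D` (`n ≥ 2`) all parts lie in `ℤ` or all lie in `1/2 + ℤ`, and `λ_2̄ ≥ |λ_1̄|`. -/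
def IsDominant (X : ClassicalType) {n : ℕ} (lam : Weight n) : Prop :=
  ∀ α ∈ simpleRoots X n, ∃ m : ℕ, corootPairing lam α = m

/-- The linear map `β ↦ β - ⟨β, α^∨⟩ α`. -/
def reflectionMap {n : ℕ} (α : Weight n) : Weight n →ₗ[ℚ] Weight n where
  toFun β := β - corootPairing β α • α
  map_add' β β' := by
    ext i
    simp only [corootPairing, add_dotProduct, Pi.sub_apply, Pi.add_apply, Pi.smul_apply,
      smul_eq_mul]
    ring
  map_smul' c β := by
    ext i
    simp only [corootPairing, smul_dotProduct, Pi.sub_apply, Pi.smul_apply, smul_eq_mul,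
      RingHom.id_apply]
    ring

theorem reflectionMap_involutive {n : ℕ} (α : Weight n) :
    Function.Involutive (reflectionMap α) := by
  intro β
  ext i
  by_cases h : α ⬝ᵥ α = 0
  · simp [reflectionMap, corootPairing, h]
  · simp only [reflectionMap, corootPairing, LinearMap.coe_mk, AddHom.coe_mk, sub_dotProduct,
      smul_dotProduct, Pi.sub_apply, Pi.smul_apply, smul_eq_mul]
    field_simp
    ring

/-- The reflection in the root `α`. -/
def reflection {n : ℕ} (α : Weight n) : Weight n ≃ₗ[ℚ] Weight n :=
  LinearEquiv.ofInvolutive (reflectionMap α) (reflectionMap_involutive α)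

/-- The Weyl group, generated by the simple reflections. -/
def weylGroup (X : ClassicalType) (n : ℕ) : Subgroup (Weight n ≃ₗ[ℚ] Weight n) :=
  Subgroup.closure (reflection '' simpleRoots X n)

/-- The length of a Weyl group element with respect to the simple reflections: the least number of
factors in an expression as a product of simple reflections. -/
noncomputable def length {X : ClassicalType} {n : ℕ} (σ : weylGroup X n) : ℕ :=
  sInf {l : ℕ | ∃ w : List (Weight n), (∀ α ∈ w, α ∈ simpleRoots X n) ∧ w.length = l ∧
    (w.map reflection).prod = (σ : Weight n ≃ₗ[ℚ] Weight n)}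

/-- The `q`-analogue of Kostant's partition function: the coefficient of `x^β` in
`∏_{α > 0} 1 / (1 - q x^α)`, i.e. the sum of `q^(∑ m_α)` over all families `(m_α)` of nonnegative
integers with `∑ m_α α = β` (there are only finitely many). -/
noncomputable def kostantPartition (X : ClassicalType) {n : ℕ} (β : Weight n) :
    Polynomial ℤ :=
  ∑ᶠ m ∈ {m : positiveRoots X n → ℕ | ∑ α, m α • (α : Weight n) = β},
    Polynomial.X ^ (∑ α, m α)

/-- The Kostka-Foulkes polynomial `K_{λ,μ}(q)`; the sum runs over the finite Weyl group. -/
noncomputable def kostkaFoulkes (X : ClassicalType) {n : ℕ} (lam mu : Weight n) :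
    Polynomial ℤ :=
  ∑ᶠ σ : weylGroup X n, (-1) ^ length σ *
    kostantPartition X ((σ : Weight n ≃ₗ[ℚ] Weight n) (lam + rho X n) - (mu + rho X n))

/-- The alternant `a_β = ∑_σ (-1)^{l(σ)} x^{σ(β)}` in the group algebra of the weights. -/
noncomputable def alternant (X : ClassicalType) {n : ℕ} (β : Weight n) :
    AddMonoidAlgebra ℤ (Weight n) :=
  ∑ᶠ σ : weylGroup X n,
    AddMonoidAlgebra.single ((σ : Weight n ≃ₗ[ℚ] Weight n) β) ((-1) ^ length σ)

/-- The Schur function `s_β = a_{β+ρ} / a_ρ`, in the fraction field of the group algebra. For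
dominant `β` it is the Weyl character of the irreducible module `V(β)`. -/
noncomputable def schur (X : ClassicalType) {n : ℕ} (β : Weight n) :
    FractionRing (AddMonoidAlgebra ℤ (Weight n)) :=
  algebraMap (AddMonoidAlgebra ℤ (Weight n)) _ (alternant X (β + rho X n)) /
    algebraMap (AddMonoidAlgebra ℤ (Weight n)) _ (alternant X (rho X n))

/-- `m` lists the multiplicities of the irreducible modules in `V(γ) ⊗ V(δ)`: it is supported on
dominant weights, and the character of `V(γ) ⊗ V(δ)` is `∑ m(λ) s_λ`. -/
def IsTensorDecomposition (X : ClassicalType) {n : ℕ} (γ δ : Weight n) (m : Weight n →₀ ℤ) :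
    Prop :=
  (∀ lam ∈ m.support, IsDominant X lam) ∧
    schur X γ * schur X δ = m.sum fun lam c => c • schur X lam

open Classical in
/-- The multiplicity of `V(λ)` in `V(γ) ⊗ V(δ)`, as a finitely supported function of `λ` (the
decomposition of the product of two irreducible characters exists and is unique). -/
noncomputable def tensorMult (X : ClassicalType) {n : ℕ} (γ δ : Weight n) : Weight n →₀ ℤ :=
  if h : ∃ m, IsTensorDecomposition X γ δ m then h.choose else 0

/-- The weight `r ε_n̄` of rank `n ≥ 1`: the highest weight of the module whose crystal consists of
the row words of length `r`. -/
def rowWeight (n r : ℕ) : Weight n := fun i => if i.val + 1 = n then (r : ℚ) else 0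

/-- The Pieri multiplicities: the value at `λ` is the multiplicity of `V(λ)` in
`V(γ) ⊗ V(r ε_n̄)`, so that the support is the set `γ ⊗ r`. -/
noncomputable def pieri (X : ClassicalType) {n : ℕ} (γ : Weight n) (r : ℕ) : Weight n →₀ ℤ :=
  tensorMult X γ (rowWeight n r)

/-- `μ'`: the largest part is deleted. -/
def dropTop {n : ℕ} (mu : Weight (n + 1)) : Weight n := fun i => mu i.castSucc

/-- `R_k = ν_k̄ + k - μ_N̄ - N` in rank `N = n + 1`, where `k : Fin (n + 1)` stands for the
number `k + 1 ∈ {1, …, N}`. -/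
def excess {n : ℕ} (nu mu : Weight (n + 1)) (k : Fin (n + 1)) : ℚ :=
  nu k + ((k.val : ℚ) + 1) - mu (Fin.last n) - ((n : ℚ) + 1)

/-- `γ_k = (ν_N̄ + 1, …, ν_{k+1} + 1, ν_{k-1}, …, ν_1)` in rank `N - 1 = n`, with the same
convention on `k`. -/
def gammaWeight {n : ℕ} (nu : Weight (n + 1)) (k : Fin (n + 1)) : Weight n :=
  fun i => if i.castSucc < k then nu i.castSucc else nu i.succ + 1

/-- The value of `R_k` in type `D`. It differs from `excess` only for the smallest index and only
if the last part `ν_1̄` is negative: then `ν_1̄` is replaced by its absolute value. -/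
def excessD {n : ℕ} (nu mu : Weight (n + 1)) (k : Fin (n + 1)) : ℚ :=
  if k = 0 ∧ nu 0 < 0 then
    -nu 0 + 1 - mu (Fin.last n) - ((n : ℚ) + 1)
  else excess nu mu k

/-- The weight `γ_k` in type `D`. It differs from `gammaWeight` only for the smallest index and
only if the last part `ν_1̄` is negative: then the last part of `γ_1` changes its sign. -/
def gammaWeightD {n : ℕ} (nu : Weight (n + 1)) (k : Fin (n + 1)) : Weight n :=
  if k = 0 ∧ nu 0 < 0 then
    fun i => if i.val = 0 then -gammaWeight nu k i else gammaWeight nu k i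
  else gammaWeight nu k

/-- The pairs `(r, m)` of nonnegative integers with `r + 2 m = R` (none if `R` is not a
nonnegative integer). -/
def rowPairs (R : ℚ) : Set (ℕ × ℕ) := {rm | (rm.1 : ℚ) + 2 * (rm.2 : ℚ) = R}

end ClassicalRoot

open ClassicalRoot Polynomial

/-! Let `L_μ` be the additive functional `x^β ↦ P_q(β - μ - ρ)` on the group algebra of the weights.
Then `K_{ν,μ}(q)` is the value of `L_μ` on the alternant `a_{ν+ρ}` (`kostkaFoulkes_eq`), and the
recurrence comes from peeling off the top coordinate on both sides of this pairing.

Alternants are determinants in the monomials `x_i^{±β_j}`, or half a sum of two such determinants in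
type `D`. Expanding along the top row writes `a_{ν+ρ}` as a signed sum over `k` of a power of the
top variable times a rank `N - 1` alternant, whose weight is `γ_k + ρ` because deleting coordinate
`k` shifts those above it by one place (`alternant_succ`, `alternant_succ_D`,
`gammaWeight_add_rho`). `P_q` vanishes when the top coordinate of its argument is negative, so only
one of the two exponents `±(ν+ρ)_k` can contribute: the positive one, except for `k = 1` in type `D`
with negative last part.

For the functional, the positive roots involving the top coordinate are `ε_N ± ε_j` and possibly an
axis root. Summing over their multiplicities with top exponent `R` gives powers of `q` times
complete symmetric functions `h_r` in the `x_j^{±1}`. The characters of the row modules are `h_r +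
h_{r-1}`, `h_r`, `h_r - h_{r-2}` in types `B`, `C`, `D`, and elementary resummations turn the result
into a sum over `r + 2m = R` of row characters (`finsum_topIndex_eq_rowPairs`, `kostkaHom_succ`).

It remains to expand `a_{γ+ρ}` times a row character in alternants of strictly dominant weights; the
coefficients are the Pieri multiplicities (`pieri_sum_kostkaFoulkes`). This needs the Weyl character
formula for row weights (`alternant_row`), obtained from a determinant of Chebyshev-like polynomials
in `x_i + x_i⁻¹` (`det_chebPoly_generating`), and the straightening of alternants
(`alternant_mem_span`). -/

namespace ClassicalRoot

/-! ### Signed permutations -/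

section SignedPerm

variable {n : ℕ}

/-- The signed permutation of the coordinates `(β_i)_i ↦ (s_i β_{π i})_i`. -/
def signedPerm (π : Equiv.Perm (Fin n)) (s : Fin n → ℤˣ) : Weight n ≃ₗ[ℚ] Weight n where
  toFun β i := ((s i : ℤ) : ℚ) * β (π i)
  map_add' β β' := by ext i; simp [mul_add]
  map_smul' c β := by ext i; simp; ring
  invFun β j := ((s (π⁻¹ j) : ℤ) : ℚ) * β (π⁻¹ j)
  left_inv β := by
    ext i
    rcases Int.units_eq_one_or (s (π.symm i)) with h | h <;> simp [h]
  right_inv β := by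
    ext i
    rcases Int.units_eq_one_or (s i) with h | h <;> simp [h]

theorem signedPerm_apply (π : Equiv.Perm (Fin n)) (s : Fin n → ℤˣ) (β : Weight n) (i : Fin n) :
    signedPerm π s β i = ((s i : ℤ) : ℚ) * β (π i) := rfl

theorem signedPerm_one : signedPerm (1 : Equiv.Perm (Fin n)) 1 = 1 := by
  ext β i
  simp [signedPerm_apply]

/-- Permutations act by pulling back coordinates, hence the reversed order `π' * π`. -/
theorem signedPerm_mul (π π' : Equiv.Perm (Fin n)) (s s' : Fin n → ℤˣ) :
    signedPerm π s * signedPerm π' s' = signedPerm (π' * π) fun i => s i * s' (π i) := by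
  apply LinearEquiv.ext
  intro β
  ext i
  rw [LinearEquiv.mul_apply]
  simp [signedPerm_apply, mul_assoc]

theorem signedPerm_injective {π π' : Equiv.Perm (Fin n)} {s s' : Fin n → ℤˣ}
    (h : signedPerm π s = signedPerm π' s') : π = π' ∧ s = s' := by
  have key : ∀ i, s i = s' i ∧ π i = π' i := fun i => by
    -- The coordinates of the test vector are positive and distinct, so an image coordinate reveals
    -- both its sign and its source.
    have h1 := congr_fun (DFunLike.congr_fun h fun j : Fin n => (j : ℚ) + 1) i
    simp only [signedPerm_apply] at h1
    have p1 : (0 : ℚ) < (π i : ℕ) + 1 := by positivity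
    have p2 : (0 : ℚ) < (π' i : ℕ) + 1 := by positivity
    rcases Int.units_eq_one_or (s i) with h2 | h2 <;>
      rcases Int.units_eq_one_or (s' i) with h3 | h3 <;> rw [h2, h3] at h1 <;>
      simp at h1
    · exact ⟨h2.trans h3.symm, Fin.ext (by exact_mod_cast h1)⟩
    · linarith
    · linarith
    · exact ⟨h2.trans h3.symm, Fin.ext h1⟩
  exact ⟨Equiv.ext fun i => (key i).2, funext fun i => (key i).1⟩

theorem det_signedPerm (π : Equiv.Perm (Fin n)) (s : Fin n → ℤˣ) :
    LinearMap.det (signedPerm π s : Weight n →ₗ[ℚ] Weight n) =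
      (((Equiv.Perm.sign π : ℤ) * ∏ i, (s i : ℤ) : ℤ) : ℚ) := by
  have h : (signedPerm π s : Weight n →ₗ[ℚ] Weight n) =
      Matrix.toLin' (Matrix.diagonal (fun i => ((s i : ℤ) : ℚ)) * π.permMatrix ℚ) := by
    apply LinearMap.ext
    intro β
    ext i
    simp [signedPerm_apply, Matrix.mulVec_diagonal, Matrix.permMatrix_mulVec]
  rw [h, LinearMap.det_toLin', Matrix.det_mul, Matrix.det_diagonal, Matrix.det_permutation]
  push_cast
  ring

/-- The sign patterns that occur in the Weyl group: in type `D` the number of signs is even. -/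
def IsAllowed (X : ClassicalType) (s : Fin n → ℤˣ) : Prop := X = .D → ∏ i, s i = 1

end SignedPerm

/-! ### Simple reflections -/

section Reflections

variable {n : ℕ}

theorem corootPairing_sub (β : Weight n) {i j : Fin n} (h : i ≠ j) :
    corootPairing β (basisVec j - basisVec i) = β j - β i := by
  have e : (basisVec j - basisVec i : Weight n) ⬝ᵥ (basisVec j - basisVec i) = 2 := by
    simp [basisVec, dotProduct_sub, h, h.symm]; norm_num
  rw [corootPairing, e]
  simp [basisVec, dotProduct_sub]

theorem corootPairing_add (β : Weight n) {i j : Fin n} (h : i ≠ j) :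
    corootPairing β (basisVec i + basisVec j) = β i + β j := by
  have e : (basisVec i + basisVec j : Weight n) ⬝ᵥ (basisVec i + basisVec j) = 2 := by
    simp [basisVec, dotProduct_add, h, h.symm]; norm_num
  rw [corootPairing, e]
  simp [basisVec, dotProduct_add]

theorem corootPairing_basisVec (β : Weight n) (i : Fin n) :
    corootPairing β (basisVec i) = 2 * β i := by
  simp [corootPairing, basisVec]

theorem corootPairing_two_smul (β : Weight n) (i : Fin n) :
    corootPairing β ((2 : ℚ) • basisVec i) = β i := by
  simp [corootPairing, basisVec]; ring

theorem reflection_apply (α β : Weight n) : reflection α β = β - corootPairing β α • α := rfl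

theorem reflection_mul_self (α : Weight n) : reflection α * reflection α = 1 := by
  apply LinearEquiv.ext
  intro β
  exact reflectionMap_involutive α β

theorem reflection_inv (α : Weight n) : (reflection α)⁻¹ = reflection α :=
  inv_eq_of_mul_eq_one_left (reflection_mul_self α)

theorem reflection_sub {i j : Fin n} (h : i ≠ j) :
    reflection (basisVec j - basisVec i : Weight n) = signedPerm (Equiv.swap i j) 1 := by
  apply LinearEquiv.ext
  intro β
  ext l
  rw [reflection_apply, corootPairing_sub β h, signedPerm_apply]
  by_cases hi : l = i
  · subst hi; simp [basisVec, h]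
  by_cases hj : l = j
  · subst hj; simp [basisVec, h.symm]
  simp [basisVec, hi, hj, Equiv.swap_apply_of_ne_of_ne hi hj]

theorem reflection_add {i j : Fin n} (h : i ≠ j) :
    reflection (basisVec i + basisVec j : Weight n) =
      signedPerm (Equiv.swap i j) fun l => if l = i ∨ l = j then -1 else 1 := by
  apply LinearEquiv.ext
  intro β
  ext l
  rw [reflection_apply, corootPairing_add β h, signedPerm_apply]
  by_cases hi : l = i
  · subst hi; simp [basisVec, h]
  by_cases hj : l = j
  · subst hj; simp [basisVec, h.symm]
  simp [basisVec, hi, hj, Equiv.swap_apply_of_ne_of_ne hi hj]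

theorem reflection_basisVec (i : Fin n) :
    reflection (basisVec i : Weight n) = signedPerm 1 fun l => if l = i then -1 else 1 := by
  apply LinearEquiv.ext
  intro β
  ext l
  rw [reflection_apply, corootPairing_basisVec, signedPerm_apply]
  by_cases hi : l = i
  · subst hi; simp [basisVec]; ring
  simp [basisVec, hi]

theorem reflection_two_smul (i : Fin n) :
    reflection ((2 : ℚ) • basisVec i : Weight n) =
      signedPerm 1 fun l => if l = i then -1 else 1 := by
  apply LinearEquiv.ext
  intro β
  ext l
  rw [reflection_apply, corootPairing_two_smul, signedPerm_apply]
  by_cases hi : l = i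
  · subst hi; simp [basisVec]; ring
  simp [basisVec, hi]

theorem simpleRoots_cases {X : ClassicalType} {α : Weight n} (hα : α ∈ simpleRoots X n) :
    (∃ i j : Fin n, j.val = i.val + 1 ∧ α = basisVec j - basisVec i) ∨
    (X = .B ∧ ∃ i : Fin n, i.val = 0 ∧ α = basisVec i) ∨
    (X = .C ∧ ∃ i : Fin n, i.val = 0 ∧ α = (2 : ℚ) • basisVec i) ∨
    (X = .D ∧ ∃ i j : Fin n, i.val = 0 ∧ j.val = 1 ∧ α = basisVec i + basisVec j) := by
  rcases hα with h | h
  · exact Or.inl h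
  · cases X
    · exact Or.inr (Or.inl ⟨rfl, h⟩)
    · exact Or.inr (Or.inr (Or.inl ⟨rfl, h⟩))
    · exact Or.inr (Or.inr (Or.inr ⟨rfl, h⟩))

theorem exists_signedPerm_of_simpleRoot {X : ClassicalType} {α : Weight n}
    (hα : α ∈ simpleRoots X n) :
    ∃ π s, IsAllowed X s ∧ (Equiv.Perm.sign π : ℤ) * ∏ i, (s i : ℤ) = -1 ∧
      reflection α = signedPerm π s := by
  rcases simpleRoots_cases hα with ⟨i, j, hij, rfl⟩ | ⟨hX, i, -, rfl⟩ | ⟨hX, i, -, rfl⟩ |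
      ⟨hX, i, j, hi, hj, rfl⟩
  · have h : i ≠ j := fun h => by subst h; omega
    exact ⟨_, _, fun _ => by simp, by simp [Equiv.Perm.sign_swap h], reflection_sub h⟩
  · refine ⟨_, _, fun h => ?_, ?_, reflection_basisVec i⟩
    · rw [hX] at h; cases h
    · simp [apply_ite]
  · refine ⟨_, _, fun h => ?_, ?_, reflection_two_smul i⟩
    · rw [hX] at h; cases h
    · simp [apply_ite]
  · have h : i ≠ j := fun h => by subst h; omega
    have hs : (Finset.univ.filter fun l : Fin n => l = i ∨ l = j) = {i, j} := by
      ext l; simp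
    refine ⟨_, _, fun _ => ?_, ?_, reflection_add h⟩
    · rw [Finset.prod_ite, hs]; simp [h]
    · simp only [apply_ite Units.val, Finset.prod_ite, hs]; simp [Equiv.Perm.sign_swap h, h]

end Reflections

/-! ### The Weyl group -/

section WeylGroup

variable {n : ℕ} {X : ClassicalType}

theorem isAllowed_mul {s t : Fin n → ℤˣ} (hs : IsAllowed X s) (ht : IsAllowed X t)
    (π : Equiv.Perm (Fin n)) : IsAllowed X fun i => s i * t (π i) := fun h => by
  rw [Finset.prod_mul_distrib, hs h, Equiv.prod_comp π t, ht h, one_mul]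

theorem exists_signedPerm_of_mem {σ : Weight n ≃ₗ[ℚ] Weight n} (hσ : σ ∈ weylGroup X n) :
    ∃ π s, IsAllowed X s ∧ σ = signedPerm π s := by
  induction hσ using Subgroup.closure_induction'' with
  | mem x hx =>
    obtain ⟨α, hα, rfl⟩ := hx
    obtain ⟨π, s, h, -, e⟩ := exists_signedPerm_of_simpleRoot hα
    exact ⟨π, s, h, e⟩
  | inv_mem x hx =>
    obtain ⟨α, hα, rfl⟩ := hx
    obtain ⟨π, s, h, -, e⟩ := exists_signedPerm_of_simpleRoot hα
    exact ⟨π, s, h, by rw [reflection_inv, e]⟩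
  | one => exact ⟨1, 1, fun _ => by simp, signedPerm_one.symm⟩
  | mul x y _ _ hx hy =>
    obtain ⟨π, s, h, rfl⟩ := hx
    obtain ⟨π', s', h', rfl⟩ := hy
    exact ⟨_, _, isAllowed_mul h h' π, signedPerm_mul ..⟩

instance : Finite (weylGroup X n) := by
  have : Set.Finite (weylGroup X n : Set (Weight n ≃ₗ[ℚ] Weight n)) :=
    (Set.finite_range fun p : Equiv.Perm (Fin n) × (Fin n → ℤˣ) => signedPerm p.1 p.2).subset
      fun σ hσ => by
        obtain ⟨π, s, -, rfl⟩ := exists_signedPerm_of_mem hσ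
        exact ⟨(π, s), rfl⟩
  exact this.to_subtype

theorem exists_simpleRoot_word {σ : Weight n ≃ₗ[ℚ] Weight n} (hσ : σ ∈ weylGroup X n) :
    ∃ w : List (Weight n), (∀ α ∈ w, α ∈ simpleRoots X n) ∧ (w.map reflection).prod = σ := by
  induction hσ using Subgroup.closure_induction'' with
  | mem x hx =>
    obtain ⟨α, hα, rfl⟩ := hx
    exact ⟨[α], by simpa, by simp⟩
  | inv_mem x hx =>
    obtain ⟨α, hα, rfl⟩ := hx
    exact ⟨[α], by simpa, by simp [reflection_inv]⟩
  | one => exact ⟨[], by simp, by simp⟩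
  | mul x y _ _ hx hy =>
    obtain ⟨w, h, rfl⟩ := hx
    obtain ⟨w', h', rfl⟩ := hy
    exact ⟨w ++ w', fun α hα => (List.mem_append.1 hα).elim (h α) (h' α), by simp⟩

theorem det_word {w : List (Weight n)} (hw : ∀ α ∈ w, α ∈ simpleRoots X n) :
    LinearMap.det (((w.map reflection).prod : Weight n ≃ₗ[ℚ] Weight n) :
      Weight n →ₗ[ℚ] Weight n) = (-1) ^ w.length := by
  induction w with
  | nil => simp
  | cons α w ih =>
    obtain ⟨π, s, -, hs, e⟩ := exists_signedPerm_of_simpleRoot (hw α (by simp))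
    have h1 : LinearMap.det (reflection α : Weight n →ₗ[ℚ] Weight n) = -1 := by
      rw [e, det_signedPerm, hs]; simp
    have h2 := ih fun α hα => hw α (by simp [hα])
    rw [List.map_cons, List.prod_cons, LinearEquiv.mul_eq_trans, LinearEquiv.coe_trans,
      LinearMap.det_comp, h1, h2, List.length_cons, pow_succ]
    ring

/-- Each simple reflection has determinant `-1`, so the parity of any word, in particular of a
shortest one, is read off from the determinant. -/
theorem neg_one_pow_length (σ : weylGroup X n) {π : Equiv.Perm (Fin n)} {s : Fin n → ℤˣ}
    (h : (σ : Weight n ≃ₗ[ℚ] Weight n) = signedPerm π s) :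
    (-1 : ℤ) ^ length σ = (Equiv.Perm.sign π : ℤ) * ∏ i, (s i : ℤ) := by
  have hne : {l : ℕ | ∃ w : List (Weight n), (∀ α ∈ w, α ∈ simpleRoots X n) ∧ w.length = l ∧
      (w.map reflection).prod = (σ : Weight n ≃ₗ[ℚ] Weight n)}.Nonempty := by
    obtain ⟨w, hw, e⟩ := exists_simpleRoot_word σ.2
    exact ⟨_, w, hw, rfl, e⟩
  obtain ⟨w, hw, hl, e⟩ := Nat.sInf_mem hne
  have h1 := det_word hw
  rw [e, h, det_signedPerm, hl] at h1
  exact_mod_cast h1.symm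

/-- Every orbit of the Weyl group meets the closed dominant chamber. -/
theorem exists_weyl_dominant (X : ClassicalType) (β : Weight n) :
    ∃ σ : weylGroup X n, ∀ α ∈ simpleRoots X n,
      0 ≤ corootPairing ((σ : Weight n ≃ₗ[ℚ] Weight n) β) α := by
  -- Every simple root pairs positively with `v`. At an orbit point maximizing the pairing with `v`,
  -- a negative coroot pairing would let a simple reflection increase it further.
  let v : Weight n := fun i => (i : ℚ) + 1
  obtain ⟨σ, hσ⟩ := Finite.exists_max fun σ : weylGroup X n =>
    (σ : Weight n ≃ₗ[ℚ] Weight n) β ⬝ᵥ v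
  refine ⟨σ, fun α hα => ?_⟩
  have h1 := hσ (⟨reflection α, Subgroup.subset_closure ⟨α, hα, rfl⟩⟩ * σ)
  simp only [Subgroup.coe_mul, LinearEquiv.mul_apply, reflection_apply, sub_dotProduct,
    smul_dotProduct, smul_eq_mul] at h1
  have h2 : 0 < α ⬝ᵥ v := by
    rcases simpleRoots_cases hα with ⟨i, j, hij, rfl⟩ | ⟨hX, i, -, rfl⟩ | ⟨hX, i, -, rfl⟩ |
      ⟨hX, i, j, hi, hj, rfl⟩
    · simp [basisVec, sub_dotProduct, v, hij]
    · simp [basisVec, v]; positivity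
    · simp [basisVec, v]; positivity
    · simp [basisVec, add_dotProduct, v]; positivity
  by_contra hneg
  rw [not_le] at hneg
  nlinarith

theorem dominant_monotone {β : Weight n}
    (h : ∀ α ∈ simpleRoots X n, 0 ≤ corootPairing β α) : Monotone β := by
  rcases n with _ | n
  · exact fun i => i.elim0
  refine Fin.monotone_iff_le_succ.2 fun i => ?_
  have hne : i.castSucc ≠ i.succ := fun h => by simp [Fin.ext_iff] at h
  have := h (basisVec i.succ - basisVec i.castSucc) (Or.inl ⟨_, _, by simp, rfl⟩)
  rw [corootPairing_sub β hne] at this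
  linarith

theorem dominant_nonneg {β : Weight n} (h : ∀ α ∈ simpleRoots X n, 0 ≤ corootPairing β α)
    (i : Fin n) (hi : X = .D → i.val ≠ 0) : 0 ≤ β i := by
  have hm := dominant_monotone h
  have h0 : 0 < n := i.pos
  by_cases hX : X = .D
  · subst hX
    have hi1 : 1 < n := by have := hi rfl; omega
    have := h (basisVec ⟨0, h0⟩ + basisVec ⟨1, hi1⟩) (Or.inr ⟨_, _, rfl, rfl, rfl⟩)
    rw [corootPairing_add β (by simp)] at this
    have h1 : β ⟨0, h0⟩ ≤ β ⟨1, hi1⟩ := hm (by simp [Fin.le_def])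
    have h2 : β ⟨1, hi1⟩ ≤ β i := hm (by have := hi rfl; simp only [Fin.le_def]; omega)
    linarith
  · have h1 : β ⟨0, h0⟩ ≤ β i := hm (by simp [Fin.le_def])
    refine le_trans ?_ h1
    cases X
    · have := h (basisVec ⟨0, h0⟩) (Or.inr ⟨_, rfl, rfl⟩)
      rw [corootPairing_basisVec] at this
      linarith
    · have := h ((2 : ℚ) • basisVec ⟨0, h0⟩) (Or.inr ⟨_, rfl, rfl⟩)
      rwa [corootPairing_two_smul] at this
    · exact absurd rfl hX

/-- The form of monotonicity that is insensitive to a negative lowest coordinate in type `D`. -/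
theorem dominant_abs_le {β : Weight n} (h : ∀ α ∈ simpleRoots X n, 0 ≤ corootPairing β α)
    {i j : Fin n} (hij : i < j) : |β i| ≤ β j := by
  have hm := dominant_monotone h
  refine abs_le'.2 ⟨hm hij.le, ?_⟩
  by_cases hX : X = .D → i.val ≠ 0
  · linarith [hm hij.le, dominant_nonneg h i hX]
  · push Not at hX
    obtain ⟨rfl, hi⟩ := hX
    have hj : i.val + 1 ≤ j.val := hij
    have h1 : i.val + 1 < n := by omega
    have h2 := h (basisVec i + basisVec ⟨i.val + 1, h1⟩) (Or.inr ⟨_, _, hi, by simp [hi], rfl⟩)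
    rw [corootPairing_add β (by simp [Fin.ext_iff])] at h2
    have h3 : β ⟨i.val + 1, h1⟩ ≤ β j := hm hj
    linarith

/-- A signed permutation mapping a strictly dominant weight into the closed dominant chamber is
trivial. -/
theorem signedPerm_eq_one {v : Weight n} (hv : StrictMono v) (hnn : ∀ i, 0 ≤ v i)
    (hpos : ∀ i, (X = .D → i.val ≠ 0) → 0 < v i)
    {π : Equiv.Perm (Fin n)} {s : Fin n → ℤˣ} (hs : IsAllowed X s)
    (h : ∀ α ∈ simpleRoots X n, 0 ≤ corootPairing (signedPerm π s v) α) : π = 1 ∧ s = 1 := by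
  have habs : ∀ i, |signedPerm π s v i| = v (π i) := fun i => by
    rw [signedPerm_apply, abs_mul, abs_of_nonneg (hnn (π i))]
    rcases Int.units_eq_one_or (s i) with h1 | h1 <;> simp [h1]
  have hπ : π = 1 := by
    -- The absolute values of the image coordinates are `v (π i)` and must be weakly increasing; an
    -- increasing permutation of `Fin n` is the identity.
    have hmono : StrictMono π := by
      refine Monotone.strictMono_of_injective (fun i j hij => ?_) π.injective
      rcases hij.eq_or_lt with rfl | hij
      · exact le_rfl
      rw [← hv.le_iff_le, ← habs, ← habs]
      exact (dominant_abs_le h hij).trans (le_abs_self _)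
    ext1 i
    exact congr_fun ((StrictMono.range_inj hmono strictMono_id).1 (by
      rw [π.surjective.range_eq, Set.range_id])) i
  subst hπ
  have key : ∀ i : Fin n, (X = .D → i.val ≠ 0) → s i = 1 := fun i hi => by
    rcases Int.units_eq_one_or (s i) with h1 | h1
    · exact h1
    · have h2 := dominant_nonneg h i hi
      have h3 := hpos i hi
      rw [signedPerm_apply, h1] at h2
      simp at h2
      linarith
  refine ⟨rfl, funext fun i => ?_⟩
  by_cases hi : X = .D → i.val ≠ 0
  · exact key i hi
  -- Only the lowest sign in type `D` is still open, because `v` may vanish there; the even number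
  -- of signs decides it.
  · push Not at hi
    obtain ⟨hX, hi⟩ := hi
    rw [Pi.one_apply, ← hs hX, Finset.prod_eq_single i (fun j _ hj => key j fun _ h => hj
      (Fin.ext (h.trans hi.symm))) (by simp)]

theorem signedPerm_mem {π : Equiv.Perm (Fin n)} {s : Fin n → ℤˣ} (hs : IsAllowed X s) :
    signedPerm π s ∈ weylGroup X n := by
  -- Some Weyl group element moves the image of the regular weight `v` back into the dominant
  -- chamber; the composite is then trivial, so the signed permutation is the inverse of that
  -- element.
  let v : Weight n := fun i => (i : ℚ) + 1
  obtain ⟨⟨σ, hσ⟩, h⟩ := exists_weyl_dominant X (signedPerm π s v)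
  obtain ⟨π', s', hs', rfl⟩ := exists_signedPerm_of_mem hσ
  simp only [← LinearEquiv.mul_apply, signedPerm_mul] at h
  have h1 := signedPerm_eq_one (X := X) (v := v) (fun i j hij => by simpa [v] using hij)
    (fun i => by positivity) (fun i _ => by positivity) (isAllowed_mul hs' hs π') h
  have h2 : signedPerm π' s' * signedPerm π s = 1 := by
    rw [signedPerm_mul, h1.1, h1.2, signedPerm_one]
  rw [← inv_eq_of_mul_eq_one_right h2]
  exact inv_mem hσ

open Classical in
/-- The elements of the Weyl group as signed permutations. -/
noncomputable def signedPermEquiv (X : ClassicalType) (n : ℕ) :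
    Equiv.Perm (Fin n) × {s : Fin n → ℤˣ // IsAllowed X s} ≃ weylGroup X n :=
  Equiv.ofBijective (fun p => ⟨signedPerm p.1 p.2, signedPerm_mem p.2.2⟩) ⟨fun p q h => by
      have h1 := signedPerm_injective (Subtype.ext_iff.1 h)
      exact Prod.ext h1.1 (Subtype.ext h1.2), fun σ => by
      obtain ⟨π, s, hs, e⟩ := exists_signedPerm_of_mem σ.2
      exact ⟨(π, ⟨s, hs⟩), Subtype.ext e.symm⟩⟩

/-- The signed permutation applied to `β`. -/
def signedAct (π : Equiv.Perm (Fin n)) (s : Fin n → ℤˣ) (β : Weight n) : Weight n :=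
  fun i => ((s i : ℤ) : ℚ) * β (π i)

open Classical in
theorem alternant_eq_sum (X : ClassicalType) (β : Weight n) :
    alternant X β = ∑ π : Equiv.Perm (Fin n), ∑ s : Fin n → ℤˣ,
      if IsAllowed X s then AddMonoidAlgebra.single (signedAct π s β)
        ((Equiv.Perm.sign π : ℤ) * ∏ i, (s i : ℤ)) else 0 := by
  rw [alternant, ← finsum_comp_equiv (signedPermEquiv X n), finsum_eq_sum_of_fintype,
    Fintype.sum_prod_type]
  refine Finset.sum_congr rfl fun π _ => ?_
  rw [← Finset.sum_filter, ← Finset.sum_subtype_eq_sum_filter, Finset.subtype_univ]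
  refine Finset.sum_congr rfl fun s _ => ?_
  rw [neg_one_pow_length (signedPermEquiv X n (π, s)) (π := π) (s := s) rfl]
  rfl

end WeylGroup
/-! ### Positive roots and the rank -/

section PositiveRoots

variable {n : ℕ} {X : ClassicalType}

/-- A weight of rank `n` followed by a top coordinate. -/
def snocWeight (β : Weight n) (b : ℚ) : Weight (n + 1) := Fin.snoc (α := fun _ => ℚ) β b

@[simp] theorem snocWeight_last (β : Weight n) (b : ℚ) : snocWeight β b (Fin.last n) = b := by
  simp [snocWeight]

@[simp] theorem snocWeight_castSucc (β : Weight n) (b : ℚ) (i : Fin n) :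
    snocWeight β b i.castSucc = β i := by
  simp [snocWeight]

theorem weight_ext_snoc {β γ : Weight (n + 1)} (h : dropTop β = dropTop γ)
    (h' : β (Fin.last n) = γ (Fin.last n)) : β = γ := by
  ext i
  induction i using Fin.lastCases with
  | last => exact h'
  | cast i => exact congr_fun h i

@[simp] theorem dropTop_snocWeight (β : Weight n) (b : ℚ) : dropTop (snocWeight β b) = β := by
  ext i; simp [dropTop]

theorem snocWeight_inj {β γ : Weight n} {b c : ℚ} :
    snocWeight β b = snocWeight γ c ↔ β = γ ∧ b = c := by
  constructor
  · intro h
    exact ⟨by simpa using congr_arg dropTop h, by simpa using congr_fun h (Fin.last n)⟩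
  · rintro ⟨rfl, rfl⟩; rfl

theorem basisVec_castSucc (i : Fin n) :
    (basisVec i.castSucc : Weight (n + 1)) = snocWeight (basisVec i) 0 := by
  apply weight_ext_snoc
  · ext j; simp [dropTop, basisVec, Pi.single_apply]
  · simp [basisVec, Fin.ext_iff, i.2.ne']

theorem basisVec_last : (basisVec (Fin.last n) : Weight (n + 1)) = snocWeight 0 1 := by
  apply weight_ext_snoc
  · ext j; simp [dropTop, basisVec]
  · simp [basisVec]

theorem snocWeight_add (β γ : Weight n) (b c : ℚ) :
    snocWeight β b + snocWeight γ c = snocWeight (β + γ) (b + c) := by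
  apply weight_ext_snoc
  · ext j; simp [dropTop]
  · simp

theorem snocWeight_sub (β γ : Weight n) (b c : ℚ) :
    snocWeight β b - snocWeight γ c = snocWeight (β - γ) (b - c) := by
  apply weight_ext_snoc
  · ext j; simp [dropTop]
  · simp

theorem snocWeight_smul (a : ℚ) (β : Weight n) (b : ℚ) :
    a • snocWeight β b = snocWeight (a • β) (a * b) := by
  apply weight_ext_snoc
  · ext j; simp [dropTop]
  · simp

theorem mem_positiveRoots {α : Weight n} : α ∈ positiveRoots X n ↔
    (∃ i j : Fin n, j < i ∧ α = basisVec i - basisVec j) ∨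
    (∃ i j : Fin n, j < i ∧ α = basisVec i + basisVec j) ∨
    (X = .B ∧ ∃ i : Fin n, α = basisVec i) ∨
    (X = .C ∧ ∃ i : Fin n, α = (2 : ℚ) • basisVec i) := by
  cases X <;> simp [positiveRoots, eq_comm]

/-- The number of positive roots of the form `c ε_i` for each `i`. -/
def numAxis : ClassicalType → ℕ
  | .B => 1
  | .C => 1
  | .D => 0

/-- The factor `c` in the positive roots `c ε_i`. -/
def axisDeg : ClassicalType → ℕ
  | .B => 1
  | .C => 2
  -- There are no axis roots in type `D`; any positive value serves.
  | .D => 1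

/-- Index type of the positive roots that involve the top coordinate. -/
abbrev TopIndex (X : ClassicalType) (n : ℕ) : Type := (Fin n ⊕ Fin n) ⊕ Fin (numAxis X)

/-- The weights `ε_j` and `-ε_j` of the vector representation. -/
def vecWeight : Fin n ⊕ Fin n → Weight n :=
  Sum.elim (fun j => basisVec j) fun j => -basisVec j

/-- The positive roots that involve the top coordinate. -/
def topRoot (X : ClassicalType) (n : ℕ) : TopIndex X n → Weight (n + 1) :=
  Sum.elim (fun j => snocWeight (-vecWeight j) 1) fun _ => snocWeight 0 (axisDeg X)

theorem vecWeight_injective : Function.Injective (vecWeight : Fin n ⊕ Fin n → Weight n) := by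
  rintro (i | i) (j | j) h
  · have := congr_fun h i
    by_cases e : i = j
    · rw [e]
    · simp [vecWeight, basisVec, e] at this
  · have := congr_fun h i
    by_cases e : i = j
    · simp [vecWeight, basisVec, e] at this; norm_num at this
    · simp [vecWeight, basisVec, e] at this
  · have := congr_fun h i
    by_cases e : i = j
    · simp [vecWeight, basisVec, e] at this; norm_num at this
    · simp [vecWeight, basisVec, e] at this
  · have := congr_fun h i
    by_cases e : i = j
    · rw [e]
    · simp [vecWeight, basisVec, e] at this

theorem vecWeight_ne_zero (j : Fin n ⊕ Fin n) : vecWeight j ≠ 0 := by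
  rcases j with j | j <;> intro h <;> simpa [vecWeight, basisVec] using congr_fun h j

theorem topRoot_injective : Function.Injective (topRoot X n) := by
  rintro (i | i) (j | j) h <;> simp only [topRoot, Sum.elim_inl, Sum.elim_inr, snocWeight_inj] at h
  · rw [vecWeight_injective (neg_injective h.1)]
  · exact absurd (neg_eq_zero.1 h.1) (vecWeight_ne_zero i)
  · exact absurd (neg_eq_zero.1 h.1.symm) (vecWeight_ne_zero j)
  · have : Subsingleton (Fin (numAxis X)) := by cases X <;> simp [numAxis] <;> infer_instance
    rw [Subsingleton.elim i j]

theorem topRoot_last_pos (t : TopIndex X n) : 0 < topRoot X n t (Fin.last n) := by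
  rcases t with t | t
  · simp [topRoot]
  · cases X <;> simp [topRoot, axisDeg]

theorem topRoot_mem (t : TopIndex X n) : topRoot X n t ∈ positiveRoots X (n + 1) := by
  rw [mem_positiveRoots]
  rcases t with (j | j) | t
  · refine Or.inl ⟨Fin.last n, j.castSucc, Fin.castSucc_lt_last j, ?_⟩
    rw [basisVec_last, basisVec_castSucc, snocWeight_sub]
    simp [topRoot, vecWeight]
  · refine Or.inr (Or.inl ⟨Fin.last n, j.castSucc, Fin.castSucc_lt_last j, ?_⟩)
    rw [basisVec_last, basisVec_castSucc, snocWeight_add]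
    simp [topRoot, vecWeight]
  · cases X
    · exact Or.inr (Or.inr (Or.inl ⟨rfl, Fin.last n, by simp [basisVec_last, topRoot, axisDeg]⟩))
    · exact Or.inr (Or.inr (Or.inr ⟨rfl, Fin.last n, by
        simp [basisVec_last, topRoot, axisDeg, snocWeight_smul]⟩))
    · exact t.elim0

theorem snocWeight_mem {α : Weight n} (h : α ∈ positiveRoots X n) :
    snocWeight α 0 ∈ positiveRoots X (n + 1) := by
  rw [mem_positiveRoots] at h ⊢
  rcases h with ⟨i, j, h, rfl⟩ | ⟨i, j, h, rfl⟩ | ⟨hX, i, rfl⟩ | ⟨hX, i, rfl⟩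
  · exact Or.inl ⟨i.castSucc, j.castSucc, h, by simp [basisVec_castSucc, snocWeight_sub]⟩
  · exact Or.inr (Or.inl ⟨i.castSucc, j.castSucc, h, by simp [basisVec_castSucc, snocWeight_add]⟩)
  · exact Or.inr (Or.inr (Or.inl ⟨hX, i.castSucc, by simp [basisVec_castSucc]⟩))
  · exact Or.inr (Or.inr (Or.inr ⟨hX, i.castSucc, by simp [basisVec_castSucc, snocWeight_smul]⟩))

theorem mem_positiveRoots_succ {α : Weight (n + 1)} (h : α ∈ positiveRoots X (n + 1)) :
    (∃ α' ∈ positiveRoots X n, α = snocWeight α' 0) ∨ ∃ t, α = topRoot X n t := by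
  rw [mem_positiveRoots] at h
  rcases h with ⟨i, j, h, rfl⟩ | ⟨i, j, h, rfl⟩ | ⟨rfl, i, rfl⟩ | ⟨rfl, i, rfl⟩
  · obtain ⟨j, rfl⟩ := Fin.exists_castSucc_eq.2 (h.trans_le (Fin.le_last i)).ne
    induction i using Fin.lastCases with
    | last => exact Or.inr ⟨Sum.inl (Sum.inl j), by
        rw [basisVec_last, basisVec_castSucc, snocWeight_sub]; simp [topRoot, vecWeight]⟩
    | cast i => exact Or.inl ⟨basisVec i - basisVec j, mem_positiveRoots.2 (Or.inl ⟨i, j, h, rfl⟩),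
        by simp [basisVec_castSucc, snocWeight_sub]⟩
  · obtain ⟨j, rfl⟩ := Fin.exists_castSucc_eq.2 (h.trans_le (Fin.le_last i)).ne
    induction i using Fin.lastCases with
    | last => exact Or.inr ⟨Sum.inl (Sum.inr j), by
        rw [basisVec_last, basisVec_castSucc, snocWeight_add]; simp [topRoot, vecWeight]⟩
    | cast i => exact Or.inl ⟨basisVec i + basisVec j,
        mem_positiveRoots.2 (Or.inr (Or.inl ⟨i, j, h, rfl⟩)),
        by simp [basisVec_castSucc, snocWeight_add]⟩
  · induction i using Fin.lastCases with
    | last => exact Or.inr ⟨Sum.inr ⟨0, Nat.one_pos⟩, by simp [basisVec_last, topRoot, axisDeg]⟩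
    | cast i => exact Or.inl ⟨basisVec i,
        mem_positiveRoots.2 (Or.inr (Or.inr (Or.inl ⟨rfl, i, rfl⟩))), by simp [basisVec_castSucc]⟩
  · induction i using Fin.lastCases with
    | last => exact Or.inr ⟨Sum.inr ⟨0, Nat.one_pos⟩, by
        simp [basisVec_last, topRoot, axisDeg, snocWeight_smul]⟩
    | cast i => exact Or.inl ⟨(2 : ℚ) • basisVec i,
        mem_positiveRoots.2 (Or.inr (Or.inr (Or.inr ⟨rfl, i, rfl⟩))),
        by simp [basisVec_castSucc, snocWeight_smul]⟩

/-- The positive roots of rank `n + 1` are those of rank `n` and those that involve the top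
coordinate. -/
noncomputable def rootEquiv (X : ClassicalType) (n : ℕ) :
    positiveRoots X n ⊕ TopIndex X n ≃ positiveRoots X (n + 1) :=
  Equiv.ofBijective (Sum.elim (fun α => ⟨snocWeight α 0, snocWeight_mem α.2⟩)
    fun t => ⟨topRoot X n t, topRoot_mem t⟩) (by
    constructor
    · rintro (i | i) (j | j) h <;>
        simp only [Sum.elim_inl, Sum.elim_inr, Subtype.mk.injEq] at h
      · rw [Subtype.ext (snocWeight_inj.1 h).1]
      · have := topRoot_last_pos j
        rw [← h] at this
        simp at this
      · have := topRoot_last_pos i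
        rw [h] at this
        simp at this
      · rw [topRoot_injective h]
    · rintro ⟨α, hα⟩
      rcases mem_positiveRoots_succ hα with ⟨α', h, rfl⟩ | ⟨t, rfl⟩
      · exact ⟨Sum.inl ⟨α', h⟩, rfl⟩
      · exact ⟨Sum.inr t, rfl⟩)

theorem rootEquiv_inl (α : positiveRoots X n) :
    (rootEquiv X n (Sum.inl α) : Weight (n + 1)) = snocWeight α 0 := rfl

theorem rootEquiv_inr (t : TopIndex X n) :
    (rootEquiv X n (Sum.inr t) : Weight (n + 1)) = topRoot X n t := rfl

/-- The constant by which the coordinates of `ρ` exceed `0, 1, 2, …`. -/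
def rhoShift : ClassicalType → ℚ
  | .B => 1 / 2
  | .C => 1
  | .D => 0

theorem sum_topRoot (t : TopIndex X n → ℕ) :
    ∑ j, t j • topRoot X n j =
      snocWeight (-∑ j, t (Sum.inl j) • vecWeight j)
        ((∑ j, t (Sum.inl j) + axisDeg X * ∑ j, t (Sum.inr j) : ℕ) : ℚ) := by
  apply weight_ext_snoc
  · ext i
    simp [dropTop, topRoot, Fintype.sum_sum_type, Finset.sum_apply, ← Finset.sum_neg_distrib,
      add_comm]
  · simp [topRoot, Fintype.sum_sum_type, Finset.sum_apply, Finset.mul_sum, mul_comm]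

theorem sum_snocWeight_zero {ι : Type*} (s : Finset ι) (f : ι → Weight n) :
    ∑ i ∈ s, snocWeight (f i) 0 = snocWeight (∑ i ∈ s, f i) 0 := by
  apply weight_ext_snoc
  · ext i; simp [dropTop, Finset.sum_apply]
  · simp [Finset.sum_apply]

theorem rho_succ (X : ClassicalType) (n : ℕ) :
    rho X (n + 1) = snocWeight (rho X n) (n + rhoShift X) := by
  have h : ∑ α ∈ positiveRoots X (n + 1), α =
      ∑ α ∈ positiveRoots X n, snocWeight α 0 + ∑ t, topRoot X n t := by
    rw [← Finset.sum_coe_sort, ← (rootEquiv X n).sum_comp, Fintype.sum_sum_type,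
      ← Finset.sum_coe_sort (positiveRoots X n)]
    rfl
  have h1 : ∑ j, (vecWeight j : Weight n) = 0 := by
    rw [Fintype.sum_sum_type]; simp [vecWeight]
  have h2 : ∑ t, topRoot X n t =
      snocWeight 0 ((Fintype.card (Fin n ⊕ Fin n) + axisDeg X * numAxis X : ℕ) : ℚ) := by
    simpa only [one_smul, h1, neg_zero, Finset.sum_const, smul_eq_mul, mul_one,
      Finset.card_univ, Fintype.card_fin] using sum_topRoot (X := X) (n := n) fun _ => 1
  rw [rho, h, h2, sum_snocWeight_zero, snocWeight_add, snocWeight_smul, add_zero, snocWeight_inj]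
  refine ⟨rfl, ?_⟩
  cases X <;> simp [numAxis, axisDeg, rhoShift] <;> ring

theorem rho_apply (X : ClassicalType) {n : ℕ} (i : Fin n) : rho X n i = i + rhoShift X := by
  induction n with
  | zero => exact i.elim0
  | succ n ih =>
    rw [rho_succ]
    induction i using Fin.lastCases with
    | last => simp
    | cast i => simp [ih]

end PositiveRoots

/-! ### The partition function and the rank -/

section Kostant

variable {n : ℕ} {X : ClassicalType}

/-- This height bounds the multiplicities in any partition into positive roots, whence
`finite_kostant`. -/
theorem positiveRoot_height {α : Weight n} (h : α ∈ positiveRoots X n) :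
    1 ≤ ∑ i, α i * ((i : ℚ) + 1) := by
  have hs : ∀ i : Fin n, ∑ l, basisVec i l * ((l : ℚ) + 1) = i + 1 := fun i => by
    simp [basisVec, Pi.single_apply]
  rw [mem_positiveRoots] at h
  rcases h with ⟨i, j, h, rfl⟩ | ⟨i, j, h, rfl⟩ | ⟨hX, i, rfl⟩ | ⟨hX, i, rfl⟩
  · have h1 : (j : ℚ) + 1 ≤ (i : ℕ) := by exact_mod_cast h
    simp only [Pi.sub_apply, sub_mul, Finset.sum_sub_distrib, hs]
    linarith
  · simp only [Pi.add_apply, add_mul, Finset.sum_add_distrib, hs]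
    have : (0 : ℚ) ≤ (i : ℕ) + (j : ℕ) := by positivity
    linarith
  · rw [hs]
    have : (0 : ℚ) ≤ (i : ℕ) := by positivity
    linarith
  · simp only [Pi.smul_apply, smul_eq_mul, mul_assoc, ← Finset.mul_sum, hs]
    have : (0 : ℚ) ≤ (i : ℕ) := by positivity
    linarith

theorem finite_kostant (X : ClassicalType) (β : Weight n) :
    {m : positiveRoots X n → ℕ | ∑ α, m α • (α : Weight n) = β}.Finite := by
  obtain ⟨K, hK⟩ := exists_nat_ge (∑ i, β i * ((i : ℚ) + 1))
  refine (Set.finite_Iic (fun _ : positiveRoots X n => K)).subset fun m hm α => ?_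
  have h1 : ∑ α, (m α : ℚ) * ∑ i, (α : Weight n) i * ((i : ℚ) + 1) =
      ∑ i, β i * ((i : ℚ) + 1) := by
    rw [← show _ = β from hm]
    simp only [Finset.mul_sum, Finset.sum_apply, Finset.sum_mul, nsmul_eq_mul]
    rw [Finset.sum_comm]
    simp [mul_assoc]
  have h2 : (m α : ℚ) ≤ ∑ α, (m α : ℚ) * ∑ i, (α : Weight n) i * ((i : ℚ) + 1) := by
    refine le_trans ?_ (Finset.single_le_sum (f := fun α : positiveRoots X n =>
      (m α : ℚ) * ∑ i, (α : Weight n) i * ((i : ℚ) + 1)) (fun α' _ => ?_) (Finset.mem_univ α))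
    · exact le_mul_of_one_le_right (by positivity) (positiveRoot_height α.2)
    · have := positiveRoot_height α'.2
      positivity
  have : (m α : ℚ) ≤ K := by linarith
  exact_mod_cast this

/-- The partition function of rank `n + 1` through that of rank `n`. -/
theorem kostantPartition_succ (X : ClassicalType) (β : Weight (n + 1)) :
    kostantPartition X β =
      ∑ᶠ t ∈ {t : TopIndex X n → ℕ |
        ((∑ j, t (Sum.inl j) + axisDeg X * ∑ j, t (Sum.inr j) : ℕ) : ℚ) = β (Fin.last n)},
        Polynomial.X ^ (∑ j, t j) *
          kostantPartition X (dropTop β + ∑ j, t (Sum.inl j) • vecWeight j) := by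
  let e : (TopIndex X n → ℕ) × (positiveRoots X n → ℕ) ≃ (positiveRoots X (n + 1) → ℕ) :=
    (Equiv.prodComm _ _).trans <| (Equiv.sumArrowEquivProdArrow _ _ _).symm.trans <|
      (rootEquiv X n).arrowCongr (Equiv.refl ℕ)
  have e1 : ∀ p α, e p (rootEquiv X n (Sum.inl α)) = p.2 α := fun p α => by
    simp [e, Equiv.sumArrowEquivProdArrow]
  have e2 : ∀ p t, e p (rootEquiv X n (Sum.inr t)) = p.1 t := fun p α => by
    simp [e, Equiv.sumArrowEquivProdArrow]
  -- The top coordinate constrains `t` alone. Below it a root `ε_N ± ε_j` equals minus a vector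
  -- weight, so carrying these roots to the other side adds vector weights.
  have hc : ∀ t m, (∑ α, e (t, m) α • (α : Weight (n + 1)) = β) ↔
      ((∑ j, t (Sum.inl j) + axisDeg X * ∑ j, t (Sum.inr j) : ℕ) : ℚ) = β (Fin.last n) ∧
      ∑ α, m α • (α : Weight n) = dropTop β + ∑ j, t (Sum.inl j) • vecWeight j := by
    intro t m
    rw [← (rootEquiv X n).sum_comp, Fintype.sum_sum_type]
    simp only [e1, e2, rootEquiv_inl, rootEquiv_inr, sum_topRoot]
    have h1 : ∑ α : positiveRoots X n, m α • snocWeight (α : Weight n) 0 =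
        snocWeight (∑ α, m α • (α : Weight n)) 0 := by
      rw [← sum_snocWeight_zero]
      simp only [← Nat.cast_smul_eq_nsmul ℚ, snocWeight_smul, mul_zero]
    have h2 : β = snocWeight (dropTop β) (β (Fin.last n)) :=
      weight_ext_snoc (by simp) (by simp)
    rw [h1, snocWeight_add, zero_add]
    conv_lhs => rw [h2, snocWeight_inj, ← sub_eq_add_neg, sub_eq_iff_eq_add]
    exact and_comm
  classical
  simp only [kostantPartition]
  rw [finsum_mem_def, ← finsum_comp_equiv e, finsum_curry]
  · rw [finsum_mem_def]
    refine finsum_congr fun t => ?_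
    by_cases ht : ((∑ j, t (Sum.inl j) + axisDeg X * ∑ j, t (Sum.inr j) : ℕ) : ℚ) =
        β (Fin.last n)
    · rw [Set.indicator_of_mem (by exact ht), mul_finsum_mem, finsum_mem_def]
      refine finsum_congr fun m => ?_
      simp only [Set.indicator_apply, Set.mem_ofPred_eq, hc, ht, true_and]
      congr 1
      rw [← pow_add, ← (rootEquiv X n).sum_comp, Fintype.sum_sum_type, add_comm]
      simp only [e1, e2]
    · rw [Set.indicator_of_notMem (by exact ht)]
      refine finsum_eq_zero_of_forall_eq_zero fun m => ?_
      rw [Set.indicator_of_notMem]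
      simp only [Set.mem_ofPred_eq, hc, ht, false_and, not_false_eq_true]
  -- Splitting the sum over pairs into an iterated `finsum` requires finite support.
  · refine ((finite_kostant X β).preimage e.injective.injOn).subset fun p hp => ?_
    rw [Function.mem_support] at hp
    exact (Set.mem_of_indicator_ne_zero hp : e p ∈ _)

end Kostant
/-! ### A determinant of orthogonal polynomials -/

section Jacobi

variable {R : Type*} [CommRing R]

/-- The polynomials with generating function `(1 + a t + b t²) / (1 - y t + t²)`. -/
noncomputable def chebPoly (a b : R) : ℕ → R[X]
  | 0 => 1
  | 1 => X + C a
  | 2 => X * (X + C a) + C (b - 1)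
  | m + 3 => X * chebPoly a b (m + 2) - chebPoly a b (m + 1)

theorem chebPoly_isMonicOfDegree [Nontrivial R] (a b : R) :
    ∀ m, IsMonicOfDegree (chebPoly a b m) m
  | 0 => by simp [chebPoly]
  | 1 => isMonicOfDegree_X_add_one a
  | 2 => by
    refine IsMonicOfDegree.add_right ((isMonicOfDegree_X R).mul (isMonicOfDegree_X_add_one a)) ?_
    rw [natDegree_C]; norm_num
  | m + 3 => by
    have h1 := chebPoly_isMonicOfDegree a b (m + 1)
    have h2 := (isMonicOfDegree_X R).mul (chebPoly_isMonicOfDegree a b (m + 2))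
    rw [chebPoly]
    rw [show 1 + (m + 2) = m + 3 by ring] at h2
    refine IsMonicOfDegree.sub h2 ?_
    rw [h1.natDegree_eq]; omega

theorem chebPoly_generating (a b y : R) :
    (1 - PowerSeries.C y * PowerSeries.X + PowerSeries.X ^ 2) *
      PowerSeries.mk (fun m => (chebPoly a b m).eval y) =
      1 + PowerSeries.C a * PowerSeries.X + PowerSeries.C b * PowerSeries.X ^ 2 := by
  ext m
  rw [add_mul, sub_mul, one_mul, mul_assoc]
  simp only [map_add, map_sub, PowerSeries.coeff_C_mul, PowerSeries.coeff_mk]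
  rcases m with _ | _ | _ | m
  · simp [chebPoly, PowerSeries.coeff_X_pow_mul', PowerSeries.coeff_X]
  · simp [chebPoly, PowerSeries.coeff_X_pow_mul', PowerSeries.coeff_succ_X_mul,
      PowerSeries.coeff_one, PowerSeries.coeff_X_pow]
  · simp [chebPoly, PowerSeries.coeff_X_pow_mul', PowerSeries.coeff_succ_X_mul,
      PowerSeries.coeff_one, PowerSeries.coeff_X_pow, PowerSeries.coeff_X]
  · simp [chebPoly, PowerSeries.coeff_X_pow_mul', PowerSeries.coeff_succ_X_mul,
      PowerSeries.coeff_one, PowerSeries.coeff_X_pow, PowerSeries.coeff_X]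

/-- The matrix is a Vandermonde matrix times the upper triangular matrix of coefficients. The
polynomials need not be monic, which is used for leading coefficients `-t`. -/
theorem det_eval_eq_vandermonde_mul_prod {k : ℕ} (v : Fin k → R) (p : Fin k → R[X])
    (h : ∀ i, (p i).natDegree ≤ i) :
    (Matrix.of fun i j => (p j).eval (v i)).det =
      (Matrix.vandermonde v).det * ∏ j, (p j).coeff j := by
  rw [Matrix.eval_matrixOfPolynomials_eq_vandermonde_mul_matrixOfPolynomials v p h,
    Matrix.det_mul, Matrix.det_of_isUpperTriangular
      (Matrix.matrixOfPolynomials_blockTriangular p h)]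
  rfl

/-- The determinants in which the last column is replaced by values of polynomials of higher
degree, as a generating function. -/
theorem det_chebPoly_generating [IsDomain R] (a b : R) {k : ℕ} (y : Fin (k + 1) → R) :
    PowerSeries.mk (fun r => (Matrix.of fun i j : Fin (k + 1) =>
        (chebPoly a b (if j = Fin.last k then k + r else j)).eval (y i)).det) *
      ∏ i, (1 - PowerSeries.C (y i) * PowerSeries.X + PowerSeries.X ^ 2) =
    (1 + PowerSeries.C a * PowerSeries.X + PowerSeries.C b * PowerSeries.X ^ 2) *
      PowerSeries.C (Matrix.of fun i j : Fin (k + 1) => (chebPoly a b j).eval (y i)).det := by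
  set N : PowerSeries R :=
    1 + PowerSeries.C a * PowerSeries.X + PowerSeries.C b * PowerSeries.X ^ 2 with hN
  set c : Fin (k + 1) → PowerSeries R :=
    fun i => 1 - PowerSeries.C (y i) * PowerSeries.X + PowerSeries.X ^ 2 with hc
  let D : ℕ → R := fun m => (Matrix.of fun i j : Fin (k + 1) =>
    (chebPoly a b (if j = Fin.last k then m else j)).eval (y i)).det
  -- Only the last column depends on the series variable `t`, and the determinant is linear in it,
  -- so `V.det` is the generating function of all the `D m`.
  let V : Matrix (Fin (k + 1)) (Fin (k + 1)) (PowerSeries R) := Matrix.of fun i j =>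
    if j = Fin.last k then PowerSeries.mk (fun m => (chebPoly a b m).eval (y i)) else
      PowerSeries.C ((chebPoly a b j).eval (y i))
  have hV : ∀ m, PowerSeries.coeff m V.det = D m := by
    intro m
    simp only [D]
    rw [Matrix.det_succ_column _ (Fin.last k), Matrix.det_succ_column _ (Fin.last k), map_sum]
    refine Finset.sum_congr rfl fun i _ => ?_
    have h1 : V.submatrix i.succAbove (Fin.last k).succAbove =
        (Matrix.of fun i' j' : Fin k => (chebPoly a b j').eval (y (i.succAbove i'))).map
          (PowerSeries.C (R := R)) := by
      ext1 i' j'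
      simp [V, (Fin.castSucc_lt_last j').ne]
    have h2 : ∀ m, (Matrix.of fun i j : Fin (k + 1) =>
        (chebPoly a b (if j = Fin.last k then m else j)).eval (y i)).submatrix i.succAbove
          (Fin.last k).succAbove =
        Matrix.of fun i' j' : Fin k => (chebPoly a b j').eval (y (i.succAbove i')) := by
      intro m
      ext1 i' j'
      simp [(Fin.castSucc_lt_last j').ne]
    have h3 : ((-1 : PowerSeries R) ^ (i.val + (Fin.last k).val)) =
        PowerSeries.C ((-1 : R) ^ (i.val + (Fin.last k).val)) := by simp
    rw [h1, h2, ← RingHom.mapMatrix_apply, ← RingHom.map_det, h3, mul_assoc,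
      PowerSeries.coeff_C_mul, PowerSeries.coeff_mul_C]
    simp [V, mul_assoc]
  -- For `m < k` the last column repeats column `m`; hence `V.det` is divisible by `t ^ k`.
  have hlow : ∀ m < k, D m = 0 := by
    intro m hm
    refine Matrix.det_zero_of_column_eq (i := Fin.last k) (j := ⟨m, by omega⟩)
      (by simp [Fin.ext_iff]; omega) fun i => ?_
    have : (⟨m, by omega⟩ : Fin (k + 1)) ≠ Fin.last k := by simp [Fin.ext_iff]; omega
    simp [this]
  have hVX : V.det = PowerSeries.X ^ k * PowerSeries.mk fun r => D (k + r) := by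
    ext m
    rw [hV, PowerSeries.coeff_X_pow_mul']
    split_ifs with h
    · rw [PowerSeries.coeff_mk, Nat.add_sub_cancel' h]
    · exact hlow m (not_le.1 h)
  have hvd : (Matrix.vandermonde y).det =
      (Matrix.of fun i j : Fin (k + 1) => (chebPoly a b j).eval (y i)).det :=
    Matrix.det_eval_matrixOfPolynomials_eq_det_vandermonde y _
      (fun i => (chebPoly_isMonicOfDegree a b i).natDegree_eq)
      (fun i => (chebPoly_isMonicOfDegree a b i).monic)
  let p : ℕ → (PowerSeries R)[X] := fun m => (chebPoly a b m).map PowerSeries.C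
  have hp : ∀ m, IsMonicOfDegree (p m) m := fun m =>
    have h := chebPoly_isMonicOfDegree a b m
    ⟨by rw [h.monic.natDegree_map, h.natDegree_eq], h.monic.map _⟩
  -- Multiplying row `i` by `1 - y_i t + t²` turns the last column into the constant `N` and column
  -- `j` into a polynomial in `y_i` of degree at most `j + 1` with coefficient `-t` in that degree.
  -- Moving the last column to the front gives polynomials of degree at most their column index.
  let Q : Fin (k + 1) → (PowerSeries R)[X] :=
    Fin.cons (C N) fun j : Fin k => (C (1 + PowerSeries.X ^ 2) - C PowerSeries.X * X) * p j
  have hQdeg : ∀ i, (Q i).natDegree ≤ i := by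
    intro i
    induction i using Fin.cases with
    | zero => simp [Q]
    | succ j =>
      simp only [Q, Fin.cons_succ]
      refine natDegree_mul_le.trans ?_
      rw [(hp j).natDegree_eq, Fin.val_succ, add_comm]
      refine Nat.add_le_add_left ?_ _
      compute_degree
  have hQcoeff : ∏ j, (Q j).coeff j = N * (-PowerSeries.X) ^ k := by
    rw [Fin.prod_univ_succ]
    congr 1
    · simp [Q]
    · rw [Finset.prod_congr rfl (g := fun _ => -PowerSeries.X), Finset.prod_const,
        Finset.card_univ, Fintype.card_fin]
      intro j _
      have h0 : (p j).coeff (j.val + 1) = 0 :=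
        coeff_eq_zero_of_natDegree_lt (by rw [(hp j).natDegree_eq]; omega)
      have h1 : (p j).coeff j.val = 1 := by
        have := (hp j).monic.coeff_natDegree
        rwa [(hp j).natDegree_eq] at this
      simp only [Q, Fin.cons_succ, Fin.val_succ, sub_mul, mul_assoc, coeff_sub, coeff_C_mul,
        coeff_X_mul, h0, h1]
      ring
  have hmat : (Matrix.of fun i j => c i * V i j) =
      (Matrix.of fun i j => (Q j).eval (PowerSeries.C (y i))).submatrix id
        (finRotate (k + 1)) := by
    ext1 i j
    induction j using Fin.lastCases with
    | last =>
      simp only [Matrix.of_apply, V, if_true, hc, Matrix.submatrix_apply, finRotate_last]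
      rw [chebPoly_generating]
      simp [Q, hN]
    | cast j =>
      have hr : finRotate (k + 1) j.castSucc = j.succ := by
        simp [finRotate_apply]
      simp only [Matrix.of_apply, V, (Fin.castSucc_lt_last j).ne, if_false, hc,
        Matrix.submatrix_apply, hr, Q, Fin.cons_succ, eval_mul, p, eval_map, Fin.val_castSucc,
        eval₂_hom]
      simp
      left
      ring
  -- The sign `(-1) ^ k` of the rotation cancels against `(-t) ^ k`, leaving the `t ^ k` that is
  -- finally divided out.
  have hdet : (∏ i, c i) * V.det =
      (-1) ^ k * (PowerSeries.C (Matrix.vandermonde y).det * (N * (-PowerSeries.X) ^ k)) := by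
    rw [← Matrix.det_mul_column, hmat, Matrix.det_permute', det_eval_eq_vandermonde_mul_prod _ _
      hQdeg, hQcoeff, sign_finRotate]
    have h1 : Matrix.vandermonde (fun i => PowerSeries.C (y i)) =
        (Matrix.vandermonde y).map PowerSeries.C := by
      ext1 i j; simp [Matrix.vandermonde_apply]
    rw [h1, ← RingHom.mapMatrix_apply, ← RingHom.map_det]
    simp
  have hXk : (PowerSeries.X : PowerSeries R) ^ k ≠ 0 := pow_ne_zero _ PowerSeries.X_ne_zero
  apply mul_left_cancel₀ hXk
  rw [← mul_assoc]
  change PowerSeries.X ^ k * PowerSeries.mk (fun r => D (k + r)) * _ = _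
  rw [← hVX, mul_comm, hdet, hvd, neg_pow PowerSeries.X]
  have h1 : ((-1 : PowerSeries R) ^ k) * (-1) ^ k = 1 := by rw [← mul_pow]; simp
  linear_combination (PowerSeries.C (Matrix.of fun i j : Fin (k + 1) =>
    (chebPoly a b j).eval (y i)).det * N * PowerSeries.X ^ k) * h1

end Jacobi
/-! ### Alternants as determinants -/

section Determinants

variable {n : ℕ}

/-- The determinant `det(c(1) x_i^{β_j} + c(-1) x_i^{-β_j})`. -/
noncomputable def signDet (c : ℤˣ → ℤ) (β : Weight n) : AddMonoidAlgebra ℤ (Weight n) :=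
  (Matrix.of fun i j => ∑ u : ℤˣ,
    AddMonoidAlgebra.single (Pi.single i (((u : ℤ) : ℚ) * β j)) (c u)).det

theorem signDet_eq_sum (c : ℤˣ → ℤ) (β : Weight n) :
    signDet c β = ∑ π : Equiv.Perm (Fin n), ∑ s : Fin n → ℤˣ,
      AddMonoidAlgebra.single (signedAct π s β)
        ((Equiv.Perm.sign π : ℤ) * ∏ i, c (s i)) := by
  rw [signDet, ← Matrix.det_transpose, Matrix.det_apply]
  refine Finset.sum_congr rfl fun π _ => ?_
  simp only [Matrix.transpose_apply, Matrix.of_apply]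
  rw [Finset.prod_univ_sum, Fintype.piFinset_univ, Finset.smul_sum]
  refine Finset.sum_congr rfl fun s _ => ?_
  rw [AddMonoidAlgebra.prod_single, Units.smul_def, AddMonoidAlgebra.smul_single, smul_eq_mul]
  congr 1
  exact Finset.univ_sum_single (signedAct π s β)

theorem alternant_eq_signDet {X : ClassicalType} (hX : X ≠ .D) (β : Weight n) :
    alternant X β = signDet (fun u => (u : ℤ)) β := by
  rw [alternant_eq_sum, signDet_eq_sum]
  refine Finset.sum_congr rfl fun π _ => Finset.sum_congr rfl fun s _ => ?_
  have hs : IsAllowed X s := fun h => absurd h hX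
  rw [if_pos hs]

/-- The indicator of an even number of signs is `(1 + ∏ s_i) / 2`, and after multiplication by `∏
s_i` it is unchanged. -/
theorem two_mul_alternant (β : Weight n) :
    2 * alternant .D β = signDet (fun _ => 1) β + signDet (fun u => (u : ℤ)) β := by
  rw [alternant_eq_sum, signDet_eq_sum, signDet_eq_sum, Finset.mul_sum, ← Finset.sum_add_distrib]
  refine Finset.sum_congr rfl fun π _ => ?_
  rw [Finset.mul_sum, ← Finset.sum_add_distrib]
  refine Finset.sum_congr rfl fun s _ => ?_
  rw [← AddMonoidAlgebra.single_add, ← Units.coe_prod, two_mul]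
  split_ifs with h
  · rw [h rfl, ← AddMonoidAlgebra.single_add]; simp
  · have h1 : ∏ i, s i = -1 := (Int.units_eq_one_or _).resolve_left fun h1 => h fun _ => h1
    simp [h1]

/-- The group algebra of rank `n` inside that of rank `n + 1`. -/
noncomputable def snocAlgHom (n : ℕ) :
    AddMonoidAlgebra ℤ (Weight n) →+* AddMonoidAlgebra ℤ (Weight (n + 1)) :=
  AddMonoidAlgebra.mapDomainRingHom ℤ
    { toFun := fun β => snocWeight β 0
      map_zero' := weight_ext_snoc (by ext; simp [dropTop]) (by simp)
      map_add' := fun β γ => by rw [snocWeight_add, add_zero] }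

theorem snocAlgHom_single (β : Weight n) (c : ℤ) :
    snocAlgHom n (AddMonoidAlgebra.single β c) =
      AddMonoidAlgebra.single (snocWeight β 0) c := by
  simp [snocAlgHom, AddMonoidAlgebra.mapDomainRingHom]

/-- Expansion along the top row. -/
theorem signDet_succ (c : ℤˣ → ℤ) (β : Weight (n + 1)) :
    signDet c β = ∑ k : Fin (n + 1), (-1) ^ (n + k.val) *
      (∑ u : ℤˣ, AddMonoidAlgebra.single (snocWeight 0 (((u : ℤ) : ℚ) * β k)) (c u)) *
        snocAlgHom n (signDet c fun i => β (k.succAbove i)) := by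
  rw [signDet, Matrix.det_succ_row _ (Fin.last n)]
  refine Finset.sum_congr rfl fun k _ => ?_
  have h1 : ∀ b : ℚ, (Pi.single (Fin.last n) b : Weight (n + 1)) = snocWeight 0 b := fun b => by
    apply weight_ext_snoc
    · ext i; simp [dropTop]
    · simp
  have h2 : ∀ (i : Fin n) (b : ℚ),
      (Pi.single i.castSucc b : Weight (n + 1)) = snocWeight (Pi.single i b) 0 := fun i b => by
    apply weight_ext_snoc
    · ext j; simp [dropTop, Pi.single_apply]
    · simp
  rw [signDet, RingHom.map_det]
  congr 2
  · simp [h1]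
  · ext1 i j
    simp [h2, snocAlgHom_single]

theorem alternant_succ {X : ClassicalType} (hX : X ≠ .D) (β : Weight (n + 1)) :
    alternant X β = ∑ k : Fin (n + 1), (-1) ^ (n + k.val) *
      (AddMonoidAlgebra.single (snocWeight 0 (β k)) 1 *
        snocAlgHom n (alternant X fun i => β (k.succAbove i)) -
      AddMonoidAlgebra.single (snocWeight 0 (-β k)) 1 *
        snocAlgHom n (alternant X fun i => β (k.succAbove i))) := by
  rw [alternant_eq_signDet hX, signDet_succ]
  refine Finset.sum_congr rfl fun k _ => ?_
  rw [alternant_eq_signDet hX, mul_assoc]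
  congr 1
  rw [← sub_mul]
  congr 1
  rw [show (Finset.univ : Finset ℤˣ) = {1, -1} from rfl, Finset.sum_pair (by decide),
    sub_eq_add_neg, ← AddMonoidAlgebra.single_neg]
  simp

/-- The weight with the lowest coordinate negated. -/
def flipBottom (β : Weight n) : Weight n := fun i => if i.val = 0 then -β i else β i

theorem signDet_flipBottom_one (β : Weight n) :
    signDet (fun _ => 1) (flipBottom β) = signDet (fun _ => 1) β := by
  rw [signDet, signDet]
  congr 1
  ext1 i j
  simp only [Matrix.of_apply, flipBottom, show (Finset.univ : Finset ℤˣ) = {1, -1} from rfl,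
    Finset.sum_pair (show (1 : ℤˣ) ≠ -1 by decide)]
  split_ifs
  · rw [add_comm]; simp
  · rfl

/-- The entries `x^b - x^{-b}` are odd in `b`, so the flip negates exactly one column. -/
theorem signDet_flipBottom_coe (hn : 0 < n) (β : Weight n) :
    signDet (fun u => (u : ℤ)) (flipBottom β) = -signDet (fun u => (u : ℤ)) β := by
  have h1 : ∏ j : Fin n, (if j.val = 0 then -1 else 1 : AddMonoidAlgebra ℤ (Weight n)) = -1 := by
    rw [Finset.prod_eq_single ⟨0, hn⟩ (fun j _ hj => if_neg fun h => hj (Fin.ext h)) (by simp)]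
    simp
  rw [signDet, signDet, ← neg_one_mul, ← h1, ← Matrix.det_mul_row]
  congr 1
  ext1 i j
  simp only [Matrix.of_apply, flipBottom, show (Finset.univ : Finset ℤˣ) = {1, -1} from rfl,
    Finset.sum_pair (show (1 : ℤˣ) ≠ -1 by decide)]
  split_ifs
  · rw [mul_add, neg_one_mul, neg_one_mul, ← AddMonoidAlgebra.single_neg,
      ← AddMonoidAlgebra.single_neg, add_comm]
    simp
  · rw [one_mul]

theorem two_ne_zero_groupAlgebra : (2 : AddMonoidAlgebra ℤ (Weight n)) ≠ 0 := by
  intro h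
  have h1 : ((2 : ℤ) : AddMonoidAlgebra ℤ (Weight n)) = 0 := by exact_mod_cast h
  rw [← zsmul_one, AddMonoidAlgebra.one_def, AddMonoidAlgebra.smul_single] at h1
  have := congr_arg (fun f => f.coeff 0) h1
  simp at this

/-- A sign on the top variable leaves an odd number of signs below it, and odd sign patterns are
even ones combined with a sign change of the bottom coordinate. Hence the flipped weight in the
second term. -/
theorem alternant_succ_D (hn : 0 < n) (β : Weight (n + 1)) :
    alternant .D β = ∑ k : Fin (n + 1), (-1) ^ (n + k.val) *
      (AddMonoidAlgebra.single (snocWeight 0 (β k)) 1 *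
        snocAlgHom n (alternant .D fun i => β (k.succAbove i)) +
      AddMonoidAlgebra.single (snocWeight 0 (-β k)) 1 *
        snocAlgHom n (alternant .D (flipBottom fun i => β (k.succAbove i)))) := by
  apply mul_left_cancel₀ two_ne_zero_groupAlgebra
  rw [two_mul_alternant, signDet_succ, signDet_succ, Finset.mul_sum, ← Finset.sum_add_distrib]
  refine Finset.sum_congr rfl fun k _ => ?_
  have h1 := congr_arg (snocAlgHom n) (two_mul_alternant fun i => β (k.succAbove i))
  have h2 := congr_arg (snocAlgHom n) (two_mul_alternant (flipBottom fun i => β (k.succAbove i)))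
  rw [signDet_flipBottom_one, signDet_flipBottom_coe hn] at h2
  simp only [map_mul, map_ofNat, map_add, map_neg] at h1 h2
  simp only [show (Finset.univ : Finset ℤˣ) = {1, -1} from rfl,
    Finset.sum_pair (show (1 : ℤˣ) ≠ -1 by decide)]
  simp only [Units.val_one, Int.cast_one, one_mul, Units.val_neg, Int.cast_neg, neg_mul,
    AddMonoidAlgebra.single_neg]
  linear_combination (-(-1) ^ (n + k.val)) *
    (AddMonoidAlgebra.single (snocWeight 0 (β k)) 1 * h1 +
      AddMonoidAlgebra.single (snocWeight 0 (-β k)) 1 * h2)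

end Determinants

/-! ### Characters of row weights -/

section RowCharacters

variable {n : ℕ}

/-- The generating function of the complete symmetric functions in `x_j` and `x_j⁻¹`. -/
noncomputable def completeSeries (n : ℕ) : PowerSeries (AddMonoidAlgebra ℤ (Weight n)) :=
  ∏ j : Fin n ⊕ Fin n, PowerSeries.mk fun k => AddMonoidAlgebra.single (k • vecWeight j) 1

/-- The coefficients of the numerator `1 + a t + b t²` of the generating function of the characters
of the row weights. -/
def numCoeff : ClassicalType → ℤ × ℤ
  | .B => (1, 0)
  | .C => (0, 0)
  | .D => (0, -1)

/-- The numerator of the generating function of the characters of the row weights. -/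
noncomputable def rowNumerator (X : ClassicalType) (n : ℕ) :
    PowerSeries (AddMonoidAlgebra ℤ (Weight n)) :=
  1 + PowerSeries.C ((numCoeff X).1 : AddMonoidAlgebra ℤ (Weight n)) * PowerSeries.X +
    PowerSeries.C ((numCoeff X).2 : AddMonoidAlgebra ℤ (Weight n)) * PowerSeries.X ^ 2

/-- The character of the irreducible module with highest weight `r ε_n̄`. -/
noncomputable def rowChar (X : ClassicalType) (n r : ℕ) : AddMonoidAlgebra ℤ (Weight n) :=
  PowerSeries.coeff r (rowNumerator X n * completeSeries n)

/-- `x_i + x_i⁻¹`. -/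
noncomputable def traceVar (i : Fin n) : AddMonoidAlgebra ℤ (Weight n) :=
  AddMonoidAlgebra.single (Pi.single i 1) 1 + AddMonoidAlgebra.single (Pi.single i (-1)) 1

theorem geometric_mul (δ : Weight n) :
    (PowerSeries.mk fun k => AddMonoidAlgebra.single (k • δ) (1 : ℤ)) *
      (1 - PowerSeries.C (AddMonoidAlgebra.single δ 1) * PowerSeries.X) = 1 := by
  ext1 m
  rw [mul_sub, mul_one, mul_left_comm, map_sub, PowerSeries.coeff_C_mul]
  rcases m with _ | m
  · simp [AddMonoidAlgebra.one_def]
  · rw [PowerSeries.coeff_succ_mul_X, PowerSeries.coeff_mk, PowerSeries.coeff_mk,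
      AddMonoidAlgebra.single_mul_single, ← succ_nsmul', mul_one, sub_self,
      PowerSeries.coeff_one, if_neg m.succ_ne_zero]

theorem completeSeries_mul (n : ℕ) :
    completeSeries n *
      ∏ i : Fin n, (1 - PowerSeries.C (traceVar i) * PowerSeries.X + PowerSeries.X ^ 2) = 1 := by
  have h : ∀ i : Fin n, 1 - PowerSeries.C (traceVar i) * PowerSeries.X + PowerSeries.X ^ 2 =
      (1 - PowerSeries.C (AddMonoidAlgebra.single (vecWeight (Sum.inl i)) 1) * PowerSeries.X) *
      (1 - PowerSeries.C (AddMonoidAlgebra.single (vecWeight (Sum.inr i)) (1 : ℤ)) *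
        PowerSeries.X) := by
    intro i
    have h1 : PowerSeries.C (AddMonoidAlgebra.single (vecWeight (Sum.inl i)) (1 : ℤ)) *
        PowerSeries.C (AddMonoidAlgebra.single (vecWeight (Sum.inr i)) 1) = 1 := by
      rw [← map_mul, AddMonoidAlgebra.single_mul_single]
      simp [vecWeight, ← AddMonoidAlgebra.one_def]
    have h2 : (traceVar i : AddMonoidAlgebra ℤ (Weight n)) =
        AddMonoidAlgebra.single (vecWeight (Sum.inl i)) 1 +
        AddMonoidAlgebra.single (vecWeight (Sum.inr i)) 1 := by
      simp [traceVar, vecWeight, basisVec, Pi.single_neg]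
    rw [h2, map_add]
    linear_combination (-PowerSeries.X ^ 2) * h1
  simp only [h, completeSeries, Fintype.prod_sum_type, Finset.prod_mul_distrib]
  rw [mul_mul_mul_comm, ← Finset.prod_mul_distrib, ← Finset.prod_mul_distrib]
  simp only [geometric_mul, Finset.prod_const_one, mul_one]

/-- `x_i^c + ε x_i^{-c}`. -/
noncomputable def signPow (i : Fin n) (ε : ℤ) (c : ℚ) : AddMonoidAlgebra ℤ (Weight n) :=
  AddMonoidAlgebra.single (Pi.single i c) 1 + AddMonoidAlgebra.single (Pi.single i (-c)) ε

/-- The three-term recurrence shared with `chebPoly`; the types differ only in `ε`, in the starting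
exponent and in the initial values. -/
theorem signPow_add_two (i : Fin n) (ε : ℤ) (c : ℚ) :
    signPow i ε (c + 2) = traceVar i * signPow i ε (c + 1) - signPow i ε c := by
  simp only [signPow, traceVar, add_mul, mul_add, AddMonoidAlgebra.single_mul_single,
    ← Pi.single_add]
  ring_nf

theorem signPow_chebPoly_B (i : Fin n) (m : ℕ) :
    signPow i (-1) (m + 1 / 2) = signPow i (-1) (1 / 2) * (chebPoly 1 0 m).eval (traceVar i) := by
  -- Oddness in the exponent starts the recurrence one step below `1 / 2`, and produces the
  -- coefficient `1` of `t` in the type `B` numerator.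
  have h0 : signPow i (-1) (-1 / 2) = -signPow i (-1) (1 / 2) := by
    simp only [signPow, AddMonoidAlgebra.single_neg]; norm_num
  have h1 : signPow i (-1) (1 + 1 / 2) = signPow i (-1) (1 / 2) * (traceVar i + 1) := by
    have := signPow_add_two i (-1) (-1 / 2)
    rw [h0] at this
    norm_num at this ⊢
    rw [this]; ring
  have step : ∀ c : ℚ, signPow i (-1) (c + 1 + 1 + 1 / 2) =
      traceVar i * signPow i (-1) (c + 1 + 1 / 2) - signPow i (-1) (c + 1 / 2) := fun c => by
    rw [show c + 1 + 1 + 1 / 2 = c + 1 / 2 + 2 by ring, signPow_add_two]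
    ring_nf
  induction m using Nat.strong_induction_on with
  | _ m ih =>
    rcases m with _ | _ | _ | m
    · simp [chebPoly]
    · simpa [chebPoly] using h1
    · have := step 0
      norm_num at this h1 ⊢
      rw [this, h1]
      simp [chebPoly]; ring
    · have h2 := ih (m + 2) (by omega)
      have h3 := ih (m + 1) (by omega)
      push_cast at h2 h3 ⊢
      rw [step, show (m : ℚ) + 1 + 1 = m + 2 by ring, h2, h3]
      simp [chebPoly]; ring

theorem signPow_chebPoly_C (i : Fin n) (m : ℕ) :
    signPow i (-1) (m + 1) = signPow i (-1) 1 * (chebPoly 0 0 m).eval (traceVar i) := by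
  have h0 : signPow i (-1) 0 = 0 := by
    simp [signPow, AddMonoidAlgebra.single_neg]
  have step : ∀ c : ℚ, signPow i (-1) (c + 1 + 1) =
      traceVar i * signPow i (-1) (c + 1) - signPow i (-1) c := fun c => by
    rw [← signPow_add_two]; ring_nf
  induction m using Nat.strong_induction_on with
  | _ m ih =>
    rcases m with _ | _ | _ | m
    · simp [chebPoly]
    · have := step 0
      rw [h0, zero_add] at this
      simp [chebPoly, this]; ring
    · have h1 := step 0
      have h2 := step 1
      rw [h0, zero_add] at h1
      norm_num at h1 h2 ⊢
      rw [h2, h1]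
      simp [chebPoly]; ring
    · have h2 := ih (m + 2) (by omega)
      have h3 := ih (m + 1) (by omega)
      push_cast at h2 h3 ⊢
      rw [show (m : ℚ) + 2 = m + 1 + 1 by ring] at h2
      rw [step, h2, h3]
      simp [chebPoly]; ring

/-- The factor `2` at `m = 0` arises because `x^0 + x^{-0} = 2` while `chebPoly` starts with `1`. -/
theorem signPow_chebPoly_D (i : Fin n) (m : ℕ) :
    signPow i 1 m = (if m = 0 then 2 else 1) * (chebPoly 0 (-1) m).eval (traceVar i) := by
  have h0 : signPow i 1 0 = 2 := by
    simp [signPow, ← AddMonoidAlgebra.one_def]; norm_num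
  have h1 : signPow i 1 1 = traceVar i := rfl
  have step : ∀ c : ℚ, signPow i 1 (c + 1 + 1) =
      traceVar i * signPow i 1 (c + 1) - signPow i 1 c := fun c => by
    rw [← signPow_add_two]; ring_nf
  induction m using Nat.strong_induction_on with
  | _ m ih =>
    rcases m with _ | _ | _ | m
    · simp [chebPoly, h0]
    · simp [chebPoly, h1]
    · have h2 := step 0
      rw [zero_add, h0, h1] at h2
      norm_num at h2 ⊢
      rw [h2]
      simp [chebPoly]; ring
    · have h2 := ih (m + 2) (by omega)
      have h3 := ih (m + 1) (by omega)
      push_cast at h2 h3 ⊢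
      rw [step, show (m : ℚ) + 1 + 1 = m + 2 by ring, h2, h3]
      simp [chebPoly]

/-- The determinant of polynomial values in the variables `x_i + x_i⁻¹` behind the alternant of
`ρ + r ε`. -/
noncomputable def chebDet (X : ClassicalType) (k r : ℕ) : AddMonoidAlgebra ℤ (Weight (k + 1)) :=
  (Matrix.of fun i j : Fin (k + 1) =>
    (chebPoly ((numCoeff X).1 : AddMonoidAlgebra ℤ (Weight (k + 1))) (numCoeff X).2
      (if j = Fin.last k then k + r else j)).eval (traceVar i)).det

/-- `completeSeries` inverts the product of the `1 - y_i t + t²` at `y_i = x_i + x_i⁻¹`; the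
identity is the coefficient of `t ^ r` in `det_chebPoly_generating`. -/
theorem chebDet_eq (X : ClassicalType) (k r : ℕ) :
    chebDet X k r = chebDet X k 0 * rowChar X (k + 1) r := by
  have h := det_chebPoly_generating ((numCoeff X).1 : AddMonoidAlgebra ℤ (Weight (k + 1)))
    (numCoeff X).2 (traceVar : Fin (k + 1) → _)
  have h1 := congr_arg (fun f => PowerSeries.coeff r (f * completeSeries (k + 1))) h
  have h2 := completeSeries_mul (k + 1)
  rw [mul_comm] at h2
  simp only [mul_assoc, h2, mul_one, PowerSeries.coeff_mk] at h1
  rw [chebDet, h1, mul_left_comm, PowerSeries.coeff_C_mul]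
  congr 1
  rw [chebDet]
  congr 1
  ext1 i j
  by_cases hj : j = Fin.last k <;> simp [hj]

theorem row_add_rho (X : ClassicalType) (k r : ℕ) (j : Fin (k + 1)) :
    (rowWeight (k + 1) r + rho X (k + 1)) j =
      ((if j = Fin.last k then k + r else j : ℕ) : ℚ) + rhoShift X := by
  rw [Pi.add_apply, rho_apply, rowWeight]
  by_cases hj : j = Fin.last k
  · simp [hj]; ring
  · have : j.val ≠ k := fun h => hj (Fin.ext h)
    simp [hj, this]

theorem signDet_coe_entry (i : Fin n) (b : ℚ) :
    ∑ u : ℤˣ, AddMonoidAlgebra.single (Pi.single i (((u : ℤ) : ℚ) * b) : Weight n) (u : ℤ) =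
      signPow i (-1) b := by
  rw [show (Finset.univ : Finset ℤˣ) = {1, -1} from rfl,
    Finset.sum_pair (show (1 : ℤˣ) ≠ -1 by decide)]
  simp [signPow]

theorem signDet_one_entry (i : Fin n) (b : ℚ) :
    ∑ u : ℤˣ, AddMonoidAlgebra.single (Pi.single i (((u : ℤ) : ℚ) * b) : Weight n) (1 : ℤ) =
      signPow i 1 b := by
  rw [show (Finset.univ : Finset ℤˣ) = {1, -1} from rfl,
    Finset.sum_pair (show (1 : ℤˣ) ≠ -1 by decide)]
  simp [signPow]

theorem alternant_row_add_rho_B (k r : ℕ) :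
    alternant .B (rowWeight (k + 1) r + rho .B (k + 1)) =
      (∏ i : Fin (k + 1), signPow i (-1) (1 / 2)) * chebDet .B k r := by
  rw [alternant_eq_signDet (by simp), signDet, chebDet, ← Matrix.det_mul_column]
  congr 1
  ext1 i j
  simp only [Matrix.of_apply, signDet_coe_entry, row_add_rho, rhoShift, numCoeff]
  rw [signPow_chebPoly_B, Int.cast_one, Int.cast_zero]

theorem alternant_row_add_rho_C (k r : ℕ) :
    alternant .C (rowWeight (k + 1) r + rho .C (k + 1)) =
      (∏ i : Fin (k + 1), signPow i (-1) 1) * chebDet .C k r := by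
  rw [alternant_eq_signDet (by simp), signDet, chebDet, ← Matrix.det_mul_column]
  congr 1
  ext1 i j
  simp only [Matrix.of_apply, signDet_coe_entry, row_add_rho, rhoShift, numCoeff]
  rw [signPow_chebPoly_C, Int.cast_zero]

theorem alternant_row_add_rho_D {k : ℕ} (hk : 0 < k) (r : ℕ) :
    alternant .D (rowWeight (k + 1) r + rho .D (k + 1)) = chebDet .D k r := by
  -- The lowest coordinate of `ρ` is `0` in type `D`, so column `0` consists of `1 - 1`. The
  -- assumption `0 < k` keeps it apart from the last column, where `r` is added.
  have h0 : signDet (fun u => (u : ℤ)) (rowWeight (k + 1) r + rho .D (k + 1)) = 0 := by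
    refine Matrix.det_eq_zero_of_column_eq_zero 0 fun i => ?_
    rw [Matrix.of_apply, signDet_coe_entry, row_add_rho]
    have : (0 : Fin (k + 1)) ≠ Fin.last k := by simp [Fin.ext_iff]; omega
    simp [this, rhoShift, signPow, AddMonoidAlgebra.single_neg]
  -- The exceptional factor `2` of column `0` matches the `2` in `two_mul_alternant`.
  have h1 : ∏ j : Fin (k + 1), (if j.val = 0 then 2 else 1 :
      AddMonoidAlgebra ℤ (Weight (k + 1))) = 2 := by
    simp
  apply mul_left_cancel₀ two_ne_zero_groupAlgebra
  rw [two_mul_alternant, h0, add_zero, signDet, chebDet]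
  conv_rhs => rw [← h1, ← Matrix.det_mul_row]
  congr 1
  ext1 i j
  simp only [Matrix.of_apply, signDet_one_entry, row_add_rho, rhoShift, numCoeff, add_zero]
  rw [signPow_chebPoly_D]
  have : ((if j = Fin.last k then k + r else j.val) = 0) ↔ j.val = 0 := by
    split_ifs with h
    · simp [h]; omega
    · rfl
  simp [this]

/-- The Weyl character formula for the row weights. -/
theorem alternant_row (X : ClassicalType) {n : ℕ} (hn : 1 ≤ n) (hD : X = .D → 2 ≤ n) (r : ℕ) :
    alternant X (rowWeight n r + rho X n) = alternant X (rho X n) * rowChar X n r := by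
  obtain ⟨k, rfl⟩ : ∃ k, n = k + 1 := ⟨n - 1, by omega⟩
  have h0 : rowWeight (k + 1) 0 = 0 := by ext i; simp [rowWeight]
  have h1 : alternant X (rho X (k + 1)) = alternant X (rowWeight (k + 1) 0 + rho X (k + 1)) := by
    rw [h0, zero_add]
  rw [h1]
  cases X
  · rw [alternant_row_add_rho_B, alternant_row_add_rho_B, chebDet_eq, mul_assoc]
  · rw [alternant_row_add_rho_C, alternant_row_add_rho_C, chebDet_eq, mul_assoc]
  · have hk : 0 < k := by have := hD rfl; omega
    rw [alternant_row_add_rho_D hk, alternant_row_add_rho_D hk, chebDet_eq]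

end RowCharacters
/-! ### Kostka–Foulkes polynomials as functionals of alternants -/

section Functional

variable {n : ℕ} {X : ClassicalType}

/-- The additive extension of a function on weights to the group algebra. -/
noncomputable def weightHom (g : Weight n → ℤ[X]) : AddMonoidAlgebra ℤ (Weight n) →+ ℤ[X] :=
  AddMonoidAlgebra.liftNC (Int.castAddHom ℤ[X]) fun β => g β.toAdd

theorem weightHom_single (g : Weight n → ℤ[X]) (β : Weight n) (c : ℤ) :
    weightHom g (AddMonoidAlgebra.single β c) = (c : ℤ[X]) * g β := by
  simp [weightHom]

theorem weightHom_single_mul (g : Weight n → ℤ[X]) (β : Weight n) (c : ℤ)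
    (f : AddMonoidAlgebra ℤ (Weight n)) :
    weightHom g (AddMonoidAlgebra.single β c * f) =
      (c : ℤ[X]) * weightHom (fun δ => g (β + δ)) f := by
  induction f using AddMonoidAlgebra.induction_linear with
  | zero => simp
  | add f f' h h' => rw [mul_add, map_add, map_add, h, h', mul_add]
  | single δ d =>
    rw [AddMonoidAlgebra.single_mul_single, weightHom_single, weightHom_single]
    push_cast
    ring

/-- The functional `x^β ↦ P_q(β - (μ + ρ))`. -/
noncomputable def kostkaHom (X : ClassicalType) (mu : Weight n) :
    AddMonoidAlgebra ℤ (Weight n) →+ ℤ[X] :=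
  weightHom fun β => kostantPartition X (β - (mu + rho X n))

theorem kostkaFoulkes_eq (X : ClassicalType) (lam mu : Weight n) :
    kostkaFoulkes X lam mu = kostkaHom X mu (alternant X (lam + rho X n)) := by
  rw [alternant, AddMonoidHom.map_finsum _ (Set.toFinite _)]
  refine finsum_congr fun σ => ?_
  rw [kostkaHom, weightHom_single]
  push_cast
  rfl

/-- The complete symmetric functions in `x_j` and `x_j⁻¹`. -/
noncomputable def completeChar (n r : ℕ) : AddMonoidAlgebra ℤ (Weight n) :=
  PowerSeries.coeff r (completeSeries n)

theorem completeChar_eq (n r : ℕ) : completeChar n r =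
    ∑ l ∈ Finset.univ.piAntidiag r, AddMonoidAlgebra.single
      (∑ j : Fin n ⊕ Fin n, l j • (vecWeight j : Weight n)) 1 := by
  rw [completeChar, completeSeries, PowerSeries.coeff_prod]
  refine Finset.sum_bij' (fun l _ => ⇑l) (fun l _ => Finsupp.equivFunOnFinite.symm l)
    (fun l hl => ?_) (fun l hl => ?_) (fun l _ => by ext; simp) (fun l _ => by ext; simp)
    fun l _ => ?_
  · simpa using hl
  · simpa using hl
  · simp only [PowerSeries.coeff_mk]
    rw [AddMonoidAlgebra.prod_single]
    simp

theorem finsum_completeChar (g : Weight n → ℤ[X]) (r : ℕ) :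
    ∑ᶠ l ∈ {l : Fin n ⊕ Fin n → ℕ | ∑ j, l j = r}, g (∑ j, l j • vecWeight j) =
      weightHom g (completeChar n r) := by
  have : {l : Fin n ⊕ Fin n → ℕ | ∑ j, l j = r} =
      ((Finset.univ.piAntidiag r : Finset (Fin n ⊕ Fin n → ℕ)) : Set _) := by
    ext l; simp
  rw [this, finsum_mem_coe_finset, completeChar_eq, map_sum]
  simp [weightHom_single]

theorem rowChar_eq (X : ClassicalType) (n r : ℕ) : rowChar X n r =
    completeChar n r + (numCoeff X).1 • (if 1 ≤ r then completeChar n (r - 1) else 0) +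
      (numCoeff X).2 • (if 2 ≤ r then completeChar n (r - 2) else 0) := by
  rw [rowChar, rowNumerator, add_mul, add_mul, one_mul, mul_assoc, mul_assoc, map_add, map_add,
    PowerSeries.coeff_C_mul, PowerSeries.coeff_C_mul, PowerSeries.coeff_X_pow_mul',
    ← pow_one PowerSeries.X, PowerSeries.coeff_X_pow_mul']
  simp [completeChar, zsmul_eq_mul]

/-! ### Branching of the partition function -/

theorem finite_rowPairs (R : ℚ) : (rowPairs R).Finite := by
  obtain ⟨K, hK⟩ := exists_nat_ge R
  refine (Set.finite_Iic (K, K)).subset fun rm h => ?_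
  have h1 : (rm.1 : ℚ) + 2 * rm.2 = R := h
  have h2 : rm.1 + 2 * rm.2 ≤ K := by
    have : ((rm.1 + 2 * rm.2 : ℕ) : ℚ) ≤ K := by push_cast; linarith
    exact_mod_cast this
  exact ⟨by simp only; omega, by simp only; omega⟩

theorem finsum_rowPairs {M : Type*} [AddCommMonoid M] (R : ℕ) (f : ℕ × ℕ → M) :
    ∑ᶠ rm ∈ rowPairs R, f rm = ∑ m ∈ Finset.range (R / 2 + 1), f (R - 2 * m, m) := by
  have h : rowPairs R =
      (((Finset.range (R / 2 + 1)).image fun m => (R - 2 * m, m) : Finset (ℕ × ℕ)) : Set _) := by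
    ext ⟨r, m⟩
    have : (r : ℚ) + 2 * m = R ↔ r + 2 * m = R := by
      rw [← Nat.cast_ofNat, ← Nat.cast_mul, ← Nat.cast_add, Nat.cast_inj]
    change (r : ℚ) + 2 * m = R ↔ _
    rw [this]
    simp
    omega
  rw [h, finsum_mem_coe_finset, Finset.sum_image]
  intro a _ b _ hab
  exact (Prod.mk.inj hab).2

theorem rowPairs_eq_empty {R : ℚ} (h : ∀ r : ℕ, (r : ℚ) ≠ R) : rowPairs R = ∅ := by
  refine Set.eq_empty_of_forall_notMem fun rm hrm => h (rm.1 + 2 * rm.2) ?_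
  push_cast
  exact hrm

/-- The exponent of `q` attached to a pair `(r, m)`. -/
def rowExp : ClassicalType → ℕ × ℕ → ℕ
  | .C, rm => rm.1 + rm.2
  | _, rm => rm.1 + 2 * rm.2

theorem axisDeg_pos (X : ClassicalType) : 0 < axisDeg X := by cases X <;> simp [axisDeg]

/-- Here `κ` records the multiplicities of the axis roots. Once `κ` is fixed, the total multiplicity
of the roots `ε_N ± ε_j` is determined, and the sum over them is a complete symmetric function. In
type `D` the only `κ` is the empty function. -/
theorem finsum_topIndex (X : ClassicalType) (R : ℕ) (g : Weight n → ℤ[X]) :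
    ∑ᶠ t ∈ {t : TopIndex X n → ℕ |
        ∑ j, t (Sum.inl j) + axisDeg X * ∑ j, t (Sum.inr j) = R},
        (Polynomial.X : ℤ[X]) ^ (∑ j, t j) * g (∑ j, t (Sum.inl j) • vecWeight j) =
      ∑ᶠ κ : Fin (numAxis X) → ℕ, if axisDeg X * ∑ j, κ j ≤ R then
        (Polynomial.X : ℤ[X]) ^ (R - axisDeg X * ∑ j, κ j + ∑ j, κ j) *
          weightHom g (completeChar n (R - axisDeg X * ∑ j, κ j)) else 0 := by
  let e : (Fin (numAxis X) → ℕ) × (Fin n ⊕ Fin n → ℕ) ≃ (TopIndex X n → ℕ) :=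
    (Equiv.prodComm _ _).trans (Equiv.sumArrowEquivProdArrow _ _ _).symm
  have e1 : ∀ p j, e p (Sum.inl j) = p.2 j := fun p j => by simp [e, Equiv.sumArrowEquivProdArrow]
  have e2 : ∀ p j, e p (Sum.inr j) = p.1 j := fun p j => by simp [e, Equiv.sumArrowEquivProdArrow]
  have hfin : {t : TopIndex X n → ℕ |
      ∑ j, t (Sum.inl j) + axisDeg X * ∑ j, t (Sum.inr j) = R}.Finite := by
    refine (Set.finite_Iic fun _ : TopIndex X n => R).subset fun t ht j => ?_
    have h1 : ∑ j, t (Sum.inl j) + axisDeg X * ∑ j, t (Sum.inr j) = R := ht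
    rcases j with j | j
    · have := Finset.single_le_sum (f := fun j => t (Sum.inl j)) (fun _ _ => Nat.zero_le _)
        (Finset.mem_univ j)
      dsimp only at this ⊢
      omega
    · have := Finset.single_le_sum (f := fun j => t (Sum.inr j)) (fun _ _ => Nat.zero_le _)
        (Finset.mem_univ j)
      have h2 := Nat.le_mul_of_pos_left (∑ j, t (Sum.inr j)) (axisDeg_pos X)
      dsimp only at this ⊢
      omega
  classical
  rw [finsum_mem_def, ← finsum_comp_equiv e, finsum_curry]
  · refine finsum_congr fun κ => ?_
    split_ifs with h
    · rw [← finsum_completeChar, mul_finsum_mem, finsum_mem_def]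
      refine finsum_congr fun l => ?_
      simp only [Set.indicator_apply, Set.mem_ofPred_eq, e1, e2,
        Fintype.sum_sum_type (α₁ := Fin n ⊕ Fin n)]
      have : (∑ j, l j + axisDeg X * ∑ j, κ j = R) ↔ ∑ j, l j = R - axisDeg X * ∑ j, κ j := by
        omega
      rw [if_congr this rfl rfl]
      split_ifs with h1
      · rw [h1]
      · rfl
    · refine finsum_eq_zero_of_forall_eq_zero fun l => ?_
      rw [Set.indicator_of_notMem]
      simp only [Set.mem_ofPred_eq, e1, e2]
      omega
  · refine (hfin.preimage e.injective.injOn).subset fun p hp => ?_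
    rw [Function.mem_support] at hp
    exact (Set.mem_of_indicator_ne_zero hp : e p ∈ _)

/-- Type `B`: the sums of consecutive terms `h_r + h_{r-1}` with `r ≡ R` modulo `2` cover each index
up to `R` once. -/
theorem sum_range_half_add_prev {M : Type*} [AddCommGroup M] (F : ℕ → M) (R : ℕ) :
    ∑ m ∈ Finset.range (R / 2 + 1),
      (F (R - 2 * m) + if 1 ≤ R - 2 * m then F (R - 2 * m - 1) else 0) =
      ∑ m ∈ Finset.range (R + 1), F m := by
  induction R using Nat.twoStepInduction with
  | zero => simp
  | one => simp [Finset.sum_range_succ, add_comm]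
  | more R ih _ =>
    rw [show (R + 2) / 2 + 1 = (R / 2 + 1) + 1 by omega, Finset.sum_range_succ',
      Finset.sum_range_succ _ (R + 1 + 1), Finset.sum_range_succ _ (R + 1), ← ih]
    have : ∀ m, R + 2 - 2 * (m + 1) = R - 2 * m := fun m => by omega
    simp only [this]
    simp
    abel

/-- Type `D`: the differences `h_r - h_{r-2}` telescope to `h_R`. -/
theorem sum_range_half_sub_prev {M : Type*} [AddCommGroup M] (F : ℕ → M) (R : ℕ) :
    ∑ m ∈ Finset.range (R / 2 + 1),
      (F (R - 2 * m) - if 2 ≤ R - 2 * m then F (R - 2 * m - 2) else 0) = F R := by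
  induction R using Nat.twoStepInduction with
  | zero => simp
  | one => simp
  | more R ih _ =>
    rw [show (R + 2) / 2 + 1 = (R / 2 + 1) + 1 by omega, Finset.sum_range_succ']
    have : ∀ m, R + 2 - 2 * (m + 1) = R - 2 * m := fun m => by omega
    simp only [this, ih]
    simp

/-- The sum over the positive roots that involve the top coordinate, through the characters of the
row weights. -/
theorem finsum_topIndex_eq_rowPairs (X : ClassicalType) (R : ℕ) (g : Weight n → ℤ[X]) :
    ∑ᶠ t ∈ {t : TopIndex X n → ℕ |
        ∑ j, t (Sum.inl j) + axisDeg X * ∑ j, t (Sum.inr j) = R},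
        (Polynomial.X : ℤ[X]) ^ (∑ j, t j) * g (∑ j, t (Sum.inl j) • vecWeight j) =
      ∑ᶠ rm ∈ rowPairs R, (Polynomial.X : ℤ[X]) ^ rowExp X rm * weightHom g (rowChar X n rm.1) := by
  rw [finsum_topIndex, finsum_rowPairs]
  cases X
  · let e : ℕ ≃ (Fin (numAxis .B) → ℕ) := (Equiv.funUnique (Fin 1) ℕ).symm
    have he : ∀ m, ∑ j, e m j = m := fun m => Fin.sum_univ_one _
    rw [← finsum_comp_equiv e]
    simp only [he, axisDeg, one_mul]
    rw [finsum_eq_sum_of_support_subset (s := Finset.range (R + 1))]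
    · have h1 := sum_range_half_add_prev (fun r => weightHom g (completeChar n r)) R
      rw [← Finset.sum_range_reflect (fun r => weightHom g (completeChar n r)) (R + 1)] at h1
      rw [Finset.sum_congr rfl (g := fun m => (Polynomial.X : ℤ[X]) ^ R *
        weightHom g (completeChar n (R + 1 - 1 - m))), ← Finset.mul_sum, ← h1, Finset.mul_sum]
      · refine Finset.sum_congr rfl fun m hm => ?_
        rw [Finset.mem_range] at hm
        rw [rowChar_eq, rowExp, show R - 2 * m + 2 * m = R by omega]
        · simp only [numCoeff, one_smul, zero_smul, add_zero, map_add]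
          split_ifs <;> simp
        · simp
      · intro m hm
        rw [Finset.mem_range] at hm
        rw [if_pos (by omega), show R - m + m = R by omega, Nat.add_sub_cancel]
    · intro m hm
      by_contra h
      refine hm (if_neg fun h' => h ?_)
      simp; omega
  · let e : ℕ ≃ (Fin (numAxis .C) → ℕ) := (Equiv.funUnique (Fin 1) ℕ).symm
    have he : ∀ m, ∑ j, e m j = m := fun m => Fin.sum_univ_one _
    rw [← finsum_comp_equiv e]
    simp only [he, axisDeg]
    rw [finsum_eq_sum_of_support_subset (s := Finset.range (R / 2 + 1))]
    · refine Finset.sum_congr rfl fun m hm => ?_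
      rw [Finset.mem_range] at hm
      rw [if_pos (by omega), rowChar_eq, rowExp]
      simp [numCoeff]
    · intro m hm
      by_contra h
      refine hm (if_neg fun h' => h ?_)
      simp; omega
  · have he : ∀ κ : Fin (numAxis .D) → ℕ, ∑ j, κ j = 0 := fun κ => Fin.sum_univ_zero _
    have : Unique (Fin (numAxis .D) → ℕ) := inferInstanceAs (Unique (Fin 0 → ℕ))
    rw [finsum_unique]
    simp only [he]
    have h1 := sum_range_half_sub_prev (fun r => weightHom g (completeChar n r)) R
    simp only [mul_zero, zero_le, if_true, Nat.sub_zero, add_zero]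
    rw [← h1, Finset.mul_sum]
    refine Finset.sum_congr rfl fun m hm => ?_
    rw [Finset.mem_range] at hm
    rw [rowChar_eq, rowExp, show R - 2 * m + 2 * m = R by omega]
    · simp only [numCoeff, zero_smul, add_zero, map_add, neg_smul, one_smul, map_neg]
      split_ifs <;> simp [sub_eq_add_neg]
    · simp

theorem kostantPartition_branching (X : ClassicalType) (β : Weight (n + 1)) :
    kostantPartition X β = ∑ᶠ rm ∈ rowPairs (β (Fin.last n)),
      (Polynomial.X : ℤ[X]) ^ rowExp X rm *
        weightHom (fun δ => kostantPartition X (dropTop β + δ)) (rowChar X n rm.1) := by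
  rw [kostantPartition_succ]
  by_cases h : ∃ R : ℕ, (R : ℚ) = β (Fin.last n)
  · obtain ⟨R, hR⟩ := h
    rw [← hR]
    simp only [Nat.cast_inj]
    exact finsum_topIndex_eq_rowPairs X R fun δ => kostantPartition X (dropTop β + δ)
  · push Not at h
    rw [rowPairs_eq_empty h, finsum_mem_empty]
    have : {t : TopIndex X n → ℕ |
        ((∑ j, t (Sum.inl j) + axisDeg X * ∑ j, t (Sum.inr j) : ℕ) : ℚ) = β (Fin.last n)} = ∅ :=
      Set.eq_empty_of_forall_notMem fun t ht => h _ ht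
    rw [this, finsum_mem_empty]

/-- The branching rule for the functional behind the Kostka–Foulkes polynomials. -/
theorem kostkaHom_succ (X : ClassicalType) (mu : Weight (n + 1)) (b : ℚ)
    (f : AddMonoidAlgebra ℤ (Weight n)) :
    kostkaHom X mu (AddMonoidAlgebra.single (snocWeight 0 b) 1 * snocAlgHom n f) =
      ∑ᶠ rm ∈ rowPairs (b - (mu + rho X (n + 1)) (Fin.last n)),
        (Polynomial.X : ℤ[X]) ^ rowExp X rm *
          kostkaHom X (dropTop mu) (f * rowChar X n rm.1) := by
  induction f using AddMonoidAlgebra.induction_linear with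
  | zero => simp
  | add f f' h h' =>
    rw [map_add, mul_add, map_add, h, h', ← finsum_mem_add_distrib (finite_rowPairs _)]
    simp only [add_mul, map_add, mul_add]
  | single β c =>
    rw [snocAlgHom_single, AddMonoidAlgebra.single_mul_single, snocWeight_add, zero_add, add_zero,
      one_mul, kostkaHom, weightHom_single, kostantPartition_branching, mul_finsum_mem]
    have h : dropTop (snocWeight β b - (mu + rho X (n + 1))) =
        β - (dropTop mu + rho X n) := by
      rw [rho_succ]
      ext i
      simp [dropTop]
    simp only [h, Pi.sub_apply, snocWeight_last, kostkaHom, weightHom_single_mul]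
    simp only [add_sub_right_comm β]
    exact finsum_mem_congr rfl fun rm _ => mul_left_comm _ _ _

end Functional
/-! ### Straightening of alternants -/

section Straightening

variable {n : ℕ} {X : ClassicalType}

theorem neg_one_pow_length_eq_det (σ : weylGroup X n) :
    (((-1 : ℤ) ^ length σ : ℤ) : ℚ) =
      LinearMap.det ((σ : Weight n ≃ₗ[ℚ] Weight n) : Weight n →ₗ[ℚ] Weight n) := by
  obtain ⟨π, s, -, h⟩ := exists_signedPerm_of_mem σ.2
  rw [neg_one_pow_length σ h, h, det_signedPerm]

theorem neg_one_pow_length_mul (σ τ : weylGroup X n) :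
    (-1 : ℤ) ^ length (σ * τ) = (-1) ^ length σ * (-1) ^ length τ := by
  have h : (((-1 : ℤ) ^ length (σ * τ) : ℤ) : ℚ) =
      (((-1) ^ length σ * (-1) ^ length τ : ℤ) : ℚ) := by
    rw [Int.cast_mul]
    simp only [neg_one_pow_length_eq_det]
    rw [Subgroup.coe_mul, LinearEquiv.mul_eq_trans, LinearEquiv.coe_trans, LinearMap.det_comp]
  exact_mod_cast h

/-- The reflection in a simple root as an element of the Weyl group. -/
def simpleReflection {α : Weight n} (hα : α ∈ simpleRoots X n) : weylGroup X n :=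
  ⟨reflection α, Subgroup.subset_closure ⟨α, hα, rfl⟩⟩

theorem neg_one_pow_length_simpleReflection {α : Weight n} (hα : α ∈ simpleRoots X n) :
    (-1 : ℤ) ^ length (simpleReflection hα) = -1 := by
  obtain ⟨π, s, -, hs, h⟩ := exists_signedPerm_of_simpleRoot hα
  rw [neg_one_pow_length _ h, hs]

/-- Reindexing the sum by right multiplication with `σ` costs the sign of `σ`. -/
theorem alternant_weyl (σ : weylGroup X n) (β : Weight n) :
    alternant X ((σ : Weight n ≃ₗ[ℚ] Weight n) β) = (-1 : ℤ) ^ length σ • alternant X β := by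
  rw [alternant, alternant]
  conv_rhs => rw [← finsum_comp_equiv (Equiv.mulRight σ)]
  rw [smul_finsum' _ (Set.toFinite _)]
  refine finsum_congr fun τ => ?_
  have h1 : (-1 : ℤ) ^ length σ * (-1) ^ length σ = 1 := by
    rw [← mul_pow]; simp
  rw [AddMonoidAlgebra.smul_single, Equiv.coe_mulRight, neg_one_pow_length_mul, smul_eq_mul,
    mul_left_comm, h1, mul_one, Subgroup.coe_mul, LinearEquiv.mul_apply]

theorem alternant_eq_zero_of_wall {β α : Weight n} (hα : α ∈ simpleRoots X n)
    (h : corootPairing β α = 0) : alternant X β = 0 := by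
  have h1 := alternant_weyl (simpleReflection hα) β
  have h2 : ((simpleReflection hα : weylGroup X n) : Weight n ≃ₗ[ℚ] Weight n) β = β := by
    change reflection α β = β
    rw [reflection_apply, h, zero_smul, sub_zero]
  rw [h2, neg_one_pow_length_simpleReflection, neg_one_smul] at h1
  have h3 : (2 : AddMonoidAlgebra ℤ (Weight n)) * alternant X β = 0 := by
    linear_combination h1
  exact (mul_eq_zero.1 h3).resolve_left two_ne_zero_groupAlgebra

/-- The weight lattice: all pairings with simple coroots are integers. -/
def InLattice (X : ClassicalType) (β : Weight n) : Prop :=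
  ∀ α ∈ simpleRoots X n, ∃ z : ℤ, corootPairing β α = z

theorem inLattice_of_isDominant {β : Weight n} (h : IsDominant X β) : InLattice X β :=
  fun α hα => by
    obtain ⟨m, hm⟩ := h α hα
    exact ⟨m, by simpa using hm⟩

theorem corootPairing_add_left (β γ α : Weight n) :
    corootPairing (β + γ) α = corootPairing β α + corootPairing γ α := by
  simp only [corootPairing, add_dotProduct]; ring

theorem corootPairing_sub_left (β γ α : Weight n) :
    corootPairing (β - γ) α = corootPairing β α - corootPairing γ α := by
  simp only [corootPairing, sub_dotProduct]; ring

theorem corootPairing_smul_left (c : ℚ) (β α : Weight n) :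
    corootPairing (c • β) α = c * corootPairing β α := by
  simp only [corootPairing, smul_dotProduct, smul_eq_mul]; ring

theorem InLattice.add {β γ : Weight n} (hβ : InLattice X β) (hγ : InLattice X γ) :
    InLattice X (β + γ) := fun α hα => by
  obtain ⟨y, hy⟩ := hβ α hα
  obtain ⟨z, hz⟩ := hγ α hα
  exact ⟨y + z, by rw [corootPairing_add_left, hy, hz]; push_cast; rfl⟩

theorem inLattice_of_integral {δ : Weight n} (h : ∀ i, ∃ z : ℤ, δ i = z) : InLattice X δ := by
  choose z hz using h
  intro α hα
  rcases simpleRoots_cases hα with ⟨i, j, hij, rfl⟩ | ⟨hX, i, -, rfl⟩ | ⟨hX, i, -, rfl⟩ |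
      ⟨hX, i, j, hi, hj, rfl⟩
  · exact ⟨z j - z i, by
      rw [corootPairing_sub δ fun h => by subst h; omega, hz, hz]; push_cast; rfl⟩
  · exact ⟨2 * z i, by rw [corootPairing_basisVec, hz]; push_cast; rfl⟩
  · exact ⟨z i, by rw [corootPairing_two_smul, hz]⟩
  · exact ⟨z i + z j, by
      rw [corootPairing_add δ fun h => by subst h; omega, hz, hz]; push_cast; rfl⟩

theorem basisVec_integral (i j : Fin n) : ∃ z : ℤ, (basisVec i : Weight n) j = z :=
  ⟨if j = i then 1 else 0, by simp [basisVec, Pi.single_apply]⟩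

theorem simpleRoot_integral {α : Weight n} (hα : α ∈ simpleRoots X n) (l : Fin n) :
    ∃ z : ℤ, α l = z := by
  choose z hz using basisVec_integral (n := n)
  rcases simpleRoots_cases hα with ⟨i, j, hij, rfl⟩ | ⟨hX, i, -, rfl⟩ | ⟨hX, i, -, rfl⟩ |
      ⟨hX, i, j, hi, hj, rfl⟩
  · exact ⟨z j l - z i l, by simp [hz]⟩
  · exact ⟨z i l, hz i l⟩
  · exact ⟨2 * z i l, by simp [hz]⟩
  · exact ⟨z i l + z j l, by simp [hz]⟩

theorem inLattice_reflection {β α : Weight n} (hα : α ∈ simpleRoots X n) (hβ : InLattice X β) :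
    InLattice X (reflection α β) := fun α' hα' => by
  obtain ⟨x, hx⟩ := hβ α' hα'
  obtain ⟨y, hy⟩ := hβ α hα
  obtain ⟨z, hz⟩ := inLattice_of_integral (simpleRoot_integral hα) α' hα'
  refine ⟨x - y * z, ?_⟩
  rw [reflection_apply, corootPairing_sub_left, corootPairing_smul_left, hx, hy, hz]
  push_cast
  rfl

theorem inLattice_weyl (σ : weylGroup X n) {β : Weight n} (hβ : InLattice X β) :
    InLattice X ((σ : Weight n ≃ₗ[ℚ] Weight n) β) := by
  obtain ⟨w, hw, h⟩ := exists_simpleRoot_word σ.2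
  rw [← h]
  clear h
  induction w with
  | nil => simpa using hβ
  | cons α w ih =>
    rw [List.map_cons, List.prod_cons, LinearEquiv.mul_apply]
    exact inLattice_reflection (hw α (by simp)) (ih fun α hα => hw α (by simp [hα]))

theorem corootPairing_rho {α : Weight n} (hα : α ∈ simpleRoots X n) :
    corootPairing (rho X n) α = 1 := by
  rcases simpleRoots_cases hα with ⟨i, j, hij, rfl⟩ | ⟨rfl, i, hi, rfl⟩ | ⟨rfl, i, hi, rfl⟩ |
      ⟨rfl, i, j, hi, hj, rfl⟩
  · rw [corootPairing_sub _ fun h => by subst h; omega, rho_apply, rho_apply, hij]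
    push_cast
    ring
  · rw [corootPairing_basisVec, rho_apply, hi]; norm_num [rhoShift]
  · rw [corootPairing_two_smul, rho_apply, hi]; norm_num [rhoShift]
  · rw [corootPairing_add _ fun h => by subst h; omega, rho_apply, rho_apply, hi, hj]
    norm_num [rhoShift]

/-- The span of the alternants of the strictly dominant weights. -/
noncomputable def alternantSpan (X : ClassicalType) (n : ℕ) :
    Submodule ℤ (AddMonoidAlgebra ℤ (Weight n)) :=
  Submodule.span ℤ ((fun lam => alternant X (lam + rho X n)) '' {lam | IsDominant X lam})

theorem alternant_mem_span {β : Weight n} (hβ : InLattice X β) :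
    alternant X β ∈ alternantSpan X n := by
  obtain ⟨σ, hσ⟩ := exists_weyl_dominant X β
  have hσβ := inLattice_weyl σ hβ
  have h1 : alternant X β =
      (-1 : ℤ) ^ length σ • alternant X ((σ : Weight n ≃ₗ[ℚ] Weight n) β) := by
    rw [alternant_weyl, smul_smul, ← mul_pow]; simp
  rw [h1]
  refine Submodule.smul_mem _ _ ?_
  by_cases hw : ∃ α ∈ simpleRoots X n, corootPairing ((σ : Weight n ≃ₗ[ℚ] Weight n) β) α = 0
  · obtain ⟨α, hα, h⟩ := hw
    rw [alternant_eq_zero_of_wall hα h]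
    exact Submodule.zero_mem _
  · push Not at hw
    refine Submodule.subset_span ⟨(σ : Weight n ≃ₗ[ℚ] Weight n) β - rho X n, fun α hα => ?_,
      by simp⟩
    obtain ⟨z, hz⟩ := hσβ α hα
    have h2 := hσ α hα
    have h3 := hw α hα
    rw [hz] at h2 h3
    have h4 : 0 ≤ z := by exact_mod_cast h2
    have h5 : z ≠ 0 := by exact_mod_cast h3
    refine ⟨(z - 1).toNat, ?_⟩
    rw [corootPairing_sub_left, corootPairing_rho hα, hz]
    have h6 : (((z - 1).toNat : ℤ) : ℚ) = ((z - 1 : ℤ) : ℚ) := by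
      rw [Int.toNat_of_nonneg (by omega)]
    rw [Int.cast_natCast] at h6
    rw [h6]
    push_cast
    rfl

/-- `ρ` has trivial stabilizer, so the monomial `x^ρ` occurs with coefficient `1`. -/
theorem alternant_rho_ne_zero (X : ClassicalType) (n : ℕ) : alternant X (rho X n) ≠ 0 := by
  have hfix : ∀ σ : weylGroup X n, (σ : Weight n ≃ₗ[ℚ] Weight n) (rho X n) = rho X n → σ = 1 := by
    intro σ hσ
    obtain ⟨π, s, hs, h⟩ := exists_signedPerm_of_mem σ.2
    have hshift : 0 ≤ rhoShift X := by cases X <;> norm_num [rhoShift]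
    have h1 := signedPerm_eq_one (X := X) (v := rho X n) (π := π) (s := s)
      (fun i j hij => by
        have : (i.val : ℚ) < j.val := by exact_mod_cast hij
        rw [rho_apply, rho_apply]; linarith)
      (fun i => by rw [rho_apply]; positivity)
      (fun i hi => by
        rw [rho_apply]
        cases X
        · simp only [rhoShift]; positivity
        · simp only [rhoShift]; positivity
        · have := Nat.pos_of_ne_zero (hi rfl)
          simp only [rhoShift]; positivity) hs
      (fun α hα => by rw [← h, hσ, corootPairing_rho hα]; norm_num)
    apply Subtype.ext
    rw [h, h1.1, h1.2, signedPerm_one, Subgroup.coe_one]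
  have := Fintype.ofFinite (weylGroup X n)
  intro h
  have h1 := congr_arg (fun f => f.coeff (rho X n)) h
  simp only [alternant, finsum_eq_sum_of_fintype, AddMonoidAlgebra.coeff_sum,
    AddMonoidAlgebra.coeff_single, Finsupp.finsetSum_apply, AddMonoidAlgebra.coeff_zero,
    Finsupp.zero_apply] at h1
  rw [Finset.sum_eq_single 1] at h1
  · simp at h1
  · intro σ _ hσ
    exact Finsupp.single_eq_of_ne fun h => hσ (hfix σ h.symm)
  · simp

end Straightening

/-! ### Products of alternants with row characters -/

section Products

variable {n : ℕ} {X : ClassicalType}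

/-- The action of a linear automorphism on the group algebra. -/
noncomputable def weightAlgHom (σ : Weight n ≃ₗ[ℚ] Weight n) :
    AddMonoidAlgebra ℤ (Weight n) →+* AddMonoidAlgebra ℤ (Weight n) :=
  AddMonoidAlgebra.mapDomainRingHom ℤ (σ : Weight n →+ Weight n)

theorem weightAlgHom_single (σ : Weight n ≃ₗ[ℚ] Weight n) (β : Weight n) (c : ℤ) :
    weightAlgHom σ (AddMonoidAlgebra.single β c) = AddMonoidAlgebra.single (σ β) c := by
  simp [weightAlgHom, AddMonoidAlgebra.mapDomainRingHom]

theorem exists_signedPerm_vecWeight (π : Equiv.Perm (Fin n)) (s : Fin n → ℤˣ)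
    (j : Fin n ⊕ Fin n) : ∃ j', signedPerm π s (vecWeight j) = vecWeight j' := by
  have h : ∀ j, signedPerm π s (basisVec j) =
      ((s (π.symm j) : ℤ) : ℚ) • (basisVec (π.symm j) : Weight n) := fun j => by
    ext i
    rw [signedPerm_apply]
    by_cases hi : i = π.symm j
    · subst hi; simp [basisVec]
    · have : π i ≠ j := fun h => hi (by simp [← h])
      simp [basisVec, hi, this]
  rcases j with j | j <;> rcases Int.units_eq_one_or (s (π.symm j)) with hs | hs
  · exact ⟨Sum.inl (π.symm j), by simp [vecWeight, h, hs]⟩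
  · exact ⟨Sum.inr (π.symm j), by simp [vecWeight, h, hs]⟩
  · exact ⟨Sum.inr (π.symm j), by simp [vecWeight, h, hs]⟩
  · exact ⟨Sum.inl (π.symm j), by simp [vecWeight, h, hs]⟩

/-- Signed permutations permute the weights `±ε_j`, hence the factors of `completeSeries`. -/
theorem weightAlgHom_completeChar (σ : weylGroup X n) (r : ℕ) :
    weightAlgHom (σ : Weight n ≃ₗ[ℚ] Weight n) (completeChar n r) = completeChar n r := by
  obtain ⟨π, s, -, h⟩ := exists_signedPerm_of_mem σ.2
  choose τ hτ using exists_signedPerm_vecWeight π s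
  have hinj : Function.Injective τ := fun i j hij => vecWeight_injective
    ((signedPerm π s).injective (by rw [hτ, hτ, hij]))
  have hbij : Function.Bijective τ := Finite.injective_iff_bijective.1 hinj
  rw [completeChar, ← PowerSeries.coeff_map, completeSeries, map_prod]
  refine congr_arg _ (Eq.trans ?_ ((Equiv.ofBijective τ hbij).prod_comp _))
  refine Finset.prod_congr rfl fun j _ => ?_
  ext1 m
  rw [PowerSeries.coeff_map, PowerSeries.coeff_mk, PowerSeries.coeff_mk, weightAlgHom_single,
    map_nsmul, h, hτ]
  rfl

/-- By invariance the symmetric factor can be moved inside the alternating sum, next to `x^β`. -/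
theorem alternant_mul_completeChar (β : Weight n) (r : ℕ) :
    alternant X β * completeChar n r =
      ∑ l ∈ Finset.univ.piAntidiag r,
        alternant X (β + ∑ j : Fin n ⊕ Fin n, l j • (vecWeight j : Weight n)) := by
  have := Fintype.ofFinite (weylGroup X n)
  simp only [alternant, finsum_eq_sum_of_fintype]
  rw [Finset.sum_mul, Finset.sum_comm]
  refine Finset.sum_congr rfl fun σ _ => ?_
  rw [← weightAlgHom_completeChar σ, completeChar_eq, map_sum, Finset.mul_sum]
  refine Finset.sum_congr rfl fun l _ => ?_
  rw [weightAlgHom_single, AddMonoidAlgebra.single_mul_single, mul_one, map_add]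

theorem alternant_mul_rowChar_mem_span {β : Weight n} (hβ : InLattice X β) (r : ℕ) :
    alternant X β * rowChar X n r ∈ alternantSpan X n := by
  have h : ∀ r, alternant X β * completeChar n r ∈ alternantSpan X n := fun r => by
    rw [alternant_mul_completeChar]
    refine Submodule.sum_mem _ fun l _ => alternant_mem_span (hβ.add (inLattice_of_integral ?_))
    intro i
    have hv : ∀ j : Fin n ⊕ Fin n, ∃ z : ℤ, (vecWeight j : Weight n) i = z := by
      rintro (j | j)
      · exact basisVec_integral j i
      · obtain ⟨z, hz⟩ := basisVec_integral j i
        exact ⟨-z, by simp [vecWeight, hz]⟩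
    choose z hz using hv
    refine ⟨∑ j, l j * z j, ?_⟩
    rw [Finset.sum_apply]
    simp [hz]
  rw [rowChar_eq, mul_add, mul_add, mul_smul_comm, mul_smul_comm]
  refine Submodule.add_mem _ (Submodule.add_mem _ (h r) (Submodule.smul_mem _ _ ?_))
    (Submodule.smul_mem _ _ ?_)
  · split_ifs
    · exact h _
    · simp
  · split_ifs
    · exact h _
    · simp

/-- By `alternant_row` the row Schur function is `rowChar`, and the remaining common denominator
`a_ρ` can be cleared, so everything happens in the group algebra. -/
theorem isTensorDecomposition_row_iff (hn : 1 ≤ n) (hD : X = .D → 2 ≤ n) (γ : Weight n) (r : ℕ)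
    (m : Weight n →₀ ℤ) :
    IsTensorDecomposition X γ (rowWeight n r) m ↔ (∀ lam ∈ m.support, IsDominant X lam) ∧
      alternant X (γ + rho X n) * rowChar X n r =
        m.sum fun lam c => c • alternant X (lam + rho X n) := by
  let A := AddMonoidAlgebra ℤ (Weight n)
  have hinj : Function.Injective (algebraMap A (FractionRing A)) :=
    IsFractionRing.injective A (FractionRing A)
  have h0 : algebraMap A (FractionRing A) (alternant X (rho X n)) ≠ 0 := fun h =>
    alternant_rho_ne_zero X n (hinj (by rw [h, map_zero]))
  have h1 : schur X γ * schur X (rowWeight n r) =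
      algebraMap A (FractionRing A) (alternant X (γ + rho X n) * rowChar X n r) /
        algebraMap A (FractionRing A) (alternant X (rho X n)) := by
    rw [schur, schur, alternant_row X hn hD, map_mul, map_mul, mul_div_cancel_left₀ _ h0,
      div_mul_eq_mul_div]
  have h2 : (m.sum fun lam c => c • schur X lam) =
      algebraMap A (FractionRing A) (m.sum fun lam c => c • alternant X (lam + rho X n)) /
        algebraMap A (FractionRing A) (alternant X (rho X n)) := by
    rw [map_finsuppSum, Finsupp.sum, Finsupp.sum, Finset.sum_div]
    refine Finset.sum_congr rfl fun lam _ => ?_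
    rw [map_zsmul, schur, smul_div_assoc]
  rw [IsTensorDecomposition, h1, h2, div_left_inj' h0, hinj.eq_iff]

theorem exists_isTensorDecomposition_row (hn : 1 ≤ n) (hD : X = .D → 2 ≤ n) {γ : Weight n}
    (hγ : InLattice X γ) (r : ℕ) : ∃ m, IsTensorDecomposition X γ (rowWeight n r) m := by
  have hρ : InLattice X (rho X n) := fun α hα => ⟨1, by rw [corootPairing_rho hα]; simp⟩
  obtain ⟨m, hm, h⟩ := (Finsupp.mem_span_image_iff_linearCombination ℤ).1
    (alternant_mul_rowChar_mem_span (hγ.add hρ) r)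
  refine ⟨m, (isTensorDecomposition_row_iff hn hD γ r m).2
    ⟨fun lam hlam => (Finsupp.mem_supported ℤ m).1 hm hlam, ?_⟩⟩
  rw [← h, Finsupp.linearCombination_apply]

/-- The sum over the Pieri multiplicities of Kostka–Foulkes polynomials. -/
theorem pieri_sum_kostkaFoulkes (hn : 1 ≤ n) (hD : X = .D → 2 ≤ n) {γ : Weight n}
    (hγ : InLattice X γ) (r : ℕ) (mu : Weight n) :
    ((pieri X γ r).sum fun lam c => c • kostkaFoulkes X lam mu) =
      kostkaHom X mu (alternant X (γ + rho X n) * rowChar X n r) := by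
  -- `pieri` is a chosen decomposition; only the identity it satisfies is used, so its uniqueness
  -- plays no role.
  have hex := exists_isTensorDecomposition_row hn hD hγ r
  have h : IsTensorDecomposition X γ (rowWeight n r) (pieri X γ r) := by
    rw [pieri, tensorMult, dif_pos hex]
    exact hex.choose_spec
  rw [((isTensorDecomposition_row_iff hn hD γ r _).1 h).2, map_finsuppSum]
  refine Finsupp.sum_congr fun lam _ => ?_
  rw [map_zsmul, kostkaFoulkes_eq]

end Products
/-! ### The Morris recurrence -/

section Recurrence

variable {n : ℕ} {X : ClassicalType}

theorem isDominant_nonneg {β : Weight n} (h : IsDominant X β) :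
    ∀ α ∈ simpleRoots X n, 0 ≤ corootPairing β α := fun α hα => by
  obtain ⟨m, hm⟩ := h α hα
  rw [hm]
  positivity

theorem rowPairs_eq_empty_of_neg {R : ℚ} (h : R < 0) : rowPairs R = ∅ :=
  rowPairs_eq_empty fun r hr => by
    have : (0 : ℚ) ≤ r := by positivity
    linarith

/-- The contribution of the pairs `(r, m)` with `r + 2 m = R` and of the weight `γ`. -/
noncomputable def rowTerm (X : ClassicalType) (mu : Weight n) (R : ℚ) (γ : Weight n) : ℤ[X] :=
  ∑ᶠ rm ∈ rowPairs R, (Polynomial.X : ℤ[X]) ^ rowExp X rm *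
    (pieri X γ rm.1).sum fun lam c => c • kostkaFoulkes X lam mu

theorem kostkaHom_alternant (hn : 1 ≤ n) (hD : X = .D → 2 ≤ n) {γ : Weight n}
    (hγ : InLattice X γ) (mu : Weight (n + 1)) (b : ℚ) :
    kostkaHom X mu (AddMonoidAlgebra.single (snocWeight 0 b) 1 *
      snocAlgHom n (alternant X (γ + rho X n))) =
      rowTerm X (dropTop mu) (b - (mu + rho X (n + 1)) (Fin.last n)) γ := by
  rw [kostkaHom_succ, rowTerm]
  simp only [pieri_sum_kostkaFoulkes hn hD hγ]

theorem kostkaHom_single_of_neg {mu : Weight (n + 1)} {b : ℚ}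
    (h : b < (mu + rho X (n + 1)) (Fin.last n)) (f : AddMonoidAlgebra ℤ (Weight n)) :
    kostkaHom X mu (AddMonoidAlgebra.single (snocWeight 0 b) 1 * snocAlgHom n f) = 0 := by
  rw [kostkaHom_succ, rowPairs_eq_empty_of_neg (by linarith), finsum_mem_empty]

/-- Coordinates above `k` drop one place, where `ρ` is smaller by `1`; the `+ 1` in `γ_k`
compensates. -/
theorem gammaWeight_add_rho (nu : Weight (n + 1)) (k : Fin (n + 1)) :
    (fun i => (nu + rho X (n + 1)) (k.succAbove i)) = gammaWeight nu k + rho X n := by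
  ext i
  simp only [Fin.succAbove, gammaWeight, Pi.add_apply, rho_apply]
  split_ifs
  · simp
  · simp; ring

theorem add_rho_sub_eq_excess (nu mu : Weight (n + 1)) (k : Fin (n + 1)) :
    (nu + rho X (n + 1)) k - (mu + rho X (n + 1)) (Fin.last n) = excess nu mu k := by
  simp only [Pi.add_apply, rho_apply, excess, Fin.val_last]
  ring

theorem InLattice.sub_integral {β : Weight (n + 1)} (h : InLattice X β) (i : Fin (n + 1)) :
    ∃ z : ℤ, β i = β 0 + z := by
  induction i using Fin.induction with
  | zero => exact ⟨0, by simp⟩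
  | succ i ih =>
    obtain ⟨y, hy⟩ := ih
    obtain ⟨z, hz⟩ := h (basisVec i.succ - basisVec i.castSucc) (Or.inl ⟨_, _, by simp, rfl⟩)
    rw [corootPairing_sub β (by simp [Fin.ext_iff])] at hz
    exact ⟨y + z, by push_cast; linarith⟩

/-- A weight of rank at least `1` whose coordinates differ by integers from those of a weight in the
weight lattice of rank one more lies in the weight lattice. -/
theorem InLattice.of_sub_integral (hn : 1 ≤ n) {β : Weight (n + 1)} (h : InLattice X β)
    {γ : Weight n} (hγ : ∀ i, ∃ z : ℤ, γ i = β 0 + z) : InLattice X γ := by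
  -- The constant weight carries the class of the coordinates modulo `ℤ`, which is all that
  -- membership in the lattice depends on. In type `D`, `2 β 0` is an integer because `β 0 + β 1`
  -- and `β 1 - β 0` are.
  have hc : InLattice X (fun _ : Fin n => β 0) := by
    intro α hα
    rcases simpleRoots_cases hα with ⟨i, j, hij, rfl⟩ | ⟨rfl, i, hi, rfl⟩ | ⟨rfl, i, hi, rfl⟩ |
      ⟨rfl, i, j, hi, hj, rfl⟩
    · exact ⟨0, by rw [corootPairing_sub _ fun h => by subst h; omega]; simp⟩
    · obtain ⟨z, hz⟩ := h (basisVec 0) (Or.inr ⟨0, rfl, rfl⟩)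
      rw [corootPairing_basisVec] at hz ⊢
      exact ⟨z, hz⟩
    · obtain ⟨z, hz⟩ := h ((2 : ℚ) • basisVec 0) (Or.inr ⟨0, rfl, rfl⟩)
      rw [corootPairing_two_smul] at hz ⊢
      exact ⟨z, hz⟩
    · have h1 : 1 < n + 1 := by omega
      obtain ⟨z, hz⟩ := h (basisVec 0 + basisVec ⟨1, h1⟩) (Or.inr ⟨0, ⟨1, h1⟩, rfl, rfl, rfl⟩)
      obtain ⟨y, hy⟩ := h.sub_integral ⟨1, h1⟩
      rw [corootPairing_add _ (by simp [Fin.ext_iff]), hy] at hz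
      rw [corootPairing_add _ fun h => by subst h; omega]
      exact ⟨z - y, by push_cast; linarith⟩
  have hd : InLattice X (γ - fun _ : Fin n => β 0) := inLattice_of_integral fun i => by
    obtain ⟨z, hz⟩ := hγ i
    exact ⟨z, by simp [hz]⟩
  simpa using hd.add hc

theorem gammaWeight_sub_integral {nu : Weight (n + 1)} (h : InLattice X nu) (k : Fin (n + 1))
    (i : Fin n) : ∃ z : ℤ, gammaWeight nu k i = nu 0 + z := by
  rw [gammaWeight]
  split_ifs
  · exact h.sub_integral _
  · obtain ⟨z, hz⟩ := h.sub_integral i.succ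
    exact ⟨z + 1, by rw [hz]; push_cast; ring⟩

theorem inLattice_gammaWeight (hn : 1 ≤ n) {nu : Weight (n + 1)} (h : InLattice X nu)
    (k : Fin (n + 1)) : InLattice X (gammaWeight nu k) :=
  h.of_sub_integral hn (gammaWeight_sub_integral h k)

theorem neg_one_pow_add_sub (k : Fin (n + 1)) :
    (-1 : ℤ[X]) ^ (n + k.val) = (-1) ^ (n - k.val) := by
  rw [show n + k.val = (n - k.val) + 2 * k.val by omega, pow_add, pow_mul]
  simp

theorem map_neg_one_pow_mul {A B : Type*} [CommRing A] [CommRing B] (φ : A →+ B) (m : ℕ) (a : A) :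
    φ ((-1) ^ m * a) = (-1) ^ m * φ a := by
  rcases neg_one_pow_eq_or A m with h | h <;> rcases Nat.even_or_odd m with h' | h' <;>
    simp [h'.neg_one_pow]

theorem kostkaFoulkes_recurrence (hX : X ≠ .D) (hn : 1 ≤ n) {nu mu : Weight (n + 1)}
    (hnu : IsDominant X nu) (hmu : IsDominant X mu) :
    kostkaFoulkes X nu mu = ∑ k : Fin (n + 1), (-1 : ℤ[X]) ^ (n - k.val) *
      rowTerm X (dropTop mu) (excess nu mu k) (gammaWeight nu k) := by
  have hL := inLattice_of_isDominant hnu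
  rw [kostkaFoulkes_eq, alternant_succ hX, map_sum]
  refine Finset.sum_congr rfl fun k _ => ?_
  have h1 := dominant_nonneg (isDominant_nonneg hnu) k fun h => absurd h hX
  have h2 := dominant_nonneg (isDominant_nonneg hmu) (Fin.last n) fun h => absurd h hX
  -- The left side is negative and the right side positive, so the monomial with the negated
  -- exponent is killed.
  have h3 : -(nu + rho X (n + 1)) k < (mu + rho X (n + 1)) (Fin.last n) := by
    have hs : 0 < rhoShift X := by
      cases X
      · norm_num [rhoShift]
      · norm_num [rhoShift]
      · exact absurd rfl hX
    have h5 : (0 : ℚ) ≤ k.val := by positivity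
    have h6 : (0 : ℚ) ≤ n := by positivity
    rw [Pi.add_apply, Pi.add_apply, rho_apply, rho_apply, Fin.val_last]
    linarith
  rw [map_neg_one_pow_mul, neg_one_pow_add_sub, map_sub, kostkaHom_single_of_neg h3, sub_zero,
    gammaWeight_add_rho, kostkaHom_alternant hn (fun h => absurd h hX)
      (inLattice_gammaWeight hn hL k), add_rho_sub_eq_excess]

/-- The flip commutes with adding `ρ` because the lowest coordinate of `ρ` vanishes in type `D`. -/
theorem flipBottom_gammaWeight_add_rho (γ : Weight n) :
    flipBottom (γ + rho .D n) =
      (fun i => if i.val = 0 then -γ i else γ i) + rho .D n := by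
  ext i
  simp only [flipBottom, Pi.add_apply, rho_apply, rhoShift]
  split_ifs with h
  · simp [h]
  · rfl

theorem kostkaFoulkes_recurrence_D (hn : 2 ≤ n) {nu mu : Weight (n + 1)}
    (hnu : IsDominant .D nu) (hmu : IsDominant .D mu) :
    kostkaFoulkes .D nu mu = ∑ k : Fin (n + 1), (-1 : ℤ[X]) ^ (n - k.val) *
      rowTerm .D (dropTop mu) (excessD nu mu k) (gammaWeightD nu k) := by
  have hL := inLattice_of_isDominant hnu
  have hn0 : (0 : ℚ) < n := by exact_mod_cast (by omega : 0 < n)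
  have hmu0 := dominant_nonneg (isDominant_nonneg hmu) (Fin.last n) fun _ => by
    simp only [Fin.val_last]; omega
  have htop : 0 < (mu + rho .D (n + 1)) (Fin.last n) := by
    rw [Pi.add_apply, rho_apply, Fin.val_last, rhoShift]
    linarith
  rw [kostkaFoulkes_eq, alternant_succ_D (by omega), map_sum]
  refine Finset.sum_congr rfl fun k _ => ?_
  rw [map_neg_one_pow_mul, neg_one_pow_add_sub, map_add, gammaWeight_add_rho]
  congr 1
  by_cases hk : k = 0 ∧ nu 0 < 0
  · obtain ⟨rfl, hneg⟩ := hk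
    -- Here `(ν + ρ)_0 = ν_0 < 0`, so the roles are exchanged: the monomial with exponent `-ν_0`
    -- survives, together with the flipped alternant. This produces the exceptional `R_1` and `γ_1`.
    have h1 : (nu + rho .D (n + 1)) 0 < (mu + rho .D (n + 1)) (Fin.last n) := by
      rw [Pi.add_apply, rho_apply, rhoShift]
      simp
      simp at htop
      linarith
    have hlat : InLattice .D (gammaWeightD nu 0) := by
      refine hL.of_sub_integral (by omega) fun i => ?_
      obtain ⟨z, hz⟩ := gammaWeight_sub_integral hL 0 i
      rw [gammaWeightD, if_pos ⟨rfl, hneg⟩]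
      split_ifs
      · have h2 : 1 < n + 1 := by omega
        obtain ⟨x, hx⟩ := hL (basisVec 0 + basisVec ⟨1, h2⟩)
          (Or.inr ⟨0, ⟨1, h2⟩, rfl, rfl, rfl⟩)
        obtain ⟨y, hy⟩ := hL.sub_integral ⟨1, h2⟩
        rw [corootPairing_add _ (by simp [Fin.ext_iff]), hy] at hx
        -- From `2 ν_0 + y = x` follows `-ν_0 = ν_0 + (y - x)`: negation preserves the class modulo
        -- `ℤ`.
        exact ⟨y - x - z, by rw [hz]; push_cast; linarith⟩
      · exact ⟨z, hz⟩
    have h2 : flipBottom (gammaWeight nu 0 + rho .D n) = gammaWeightD nu 0 + rho .D n := by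
      rw [flipBottom_gammaWeight_add_rho, gammaWeightD, if_pos ⟨rfl, hneg⟩]
    have h3 : -(nu + rho .D (n + 1)) 0 - (mu + rho .D (n + 1)) (Fin.last n) =
        excessD nu mu 0 := by
      rw [excessD, if_pos ⟨rfl, hneg⟩]
      simp only [Pi.add_apply, rho_apply, rhoShift, Fin.val_last, Fin.val_zero]
      push_cast
      ring
    rw [kostkaHom_single_of_neg h1, zero_add, h2, kostkaHom_alternant (by omega) (fun _ => hn) hlat,
      h3]
  · have hnn : 0 ≤ nu k := by
      by_cases h0 : k = 0
      · subst h0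
        push Not at hk
        exact hk rfl
      · exact dominant_nonneg (isDominant_nonneg hnu) k fun _ h => h0 (Fin.ext h)
    have h1 : -(nu + rho .D (n + 1)) k < (mu + rho .D (n + 1)) (Fin.last n) := by
      have : (0 : ℚ) ≤ k.val := by positivity
      rw [Pi.add_apply, rho_apply, rhoShift]
      linarith
    rw [kostkaHom_single_of_neg h1, add_zero, kostkaHom_alternant (by omega) (fun _ => hn)
      (inLattice_gammaWeight (by omega) hL k), add_rho_sub_eq_excess, excessD, if_neg hk,
      gammaWeightD, if_neg hk]

/-- Truncates the sum over all `k`: indices below `p` have `R_k < 0`, for which no pair `(r, m)`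
exists. -/
theorem sum_eq_sum_Icc_and_eq_zero {K : ℤ[X]} {E : Fin (n + 1) → ℚ} {F : Fin (n + 1) → ℤ[X]}
    (hK : K = ∑ k, F k) (hF : ∀ k, E k < 0 → F k = 0) :
    (∀ p, IsLeast {k | 0 ≤ E k} p → K = ∑ k ∈ Finset.Icc p (Fin.last n), F k) ∧
      ((∀ k, E k < 0) → K = 0) := by
  refine ⟨fun p hp => ?_, fun h => ?_⟩
  · rw [hK]
    refine (Finset.sum_subset (Finset.subset_univ _) fun k _ hk => hF k ?_).symm
    by_contra h
    exact hk (Finset.mem_Icc.2 ⟨hp.2 (not_lt.1 h), Fin.le_last k⟩)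
  · rw [hK]
    exact Finset.sum_eq_zero fun k _ => hF k (h k)

end Recurrence
end ClassicalRoot

/-- Ranks `N = n + 1` and `N - 1 = n`; an index `k : Fin (n + 1)` stands for `k + 1 ∈ {1, …, N}`.
On the pairs `(r, m)` with `r + 2 m = R_k` one has `q ^ R_k = q ^ (r + 2 m)` and
`q ^ (R_k - m) = q ^ (r + m)`. -/
theorem theorem3p3 (n : ℕ) (nu mu : Weight (n + 1)) :
    -- type B
    (1 ≤ n → IsDominant .B nu → IsDominant .B mu →
      (∀ p : Fin (n + 1), IsLeast {k | 0 ≤ excess nu mu k} p →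
        kostkaFoulkes .B nu mu =
          ∑ k ∈ Finset.Icc p (Fin.last n), (-1 : ℤ[X]) ^ (n - k.val) *
            ∑ᶠ rm ∈ rowPairs (excess nu mu k), X ^ (rm.1 + 2 * rm.2) *
              (pieri .B (gammaWeight nu k) rm.1).sum fun lam b =>
                b • kostkaFoulkes .B lam (dropTop mu)) ∧
      ((∀ k : Fin (n + 1), excess nu mu k < 0) → kostkaFoulkes .B nu mu = 0)) ∧
    -- type C
    (1 ≤ n → IsDominant .C nu → IsDominant .C mu →
      (∀ p : Fin (n + 1), IsLeast {k | 0 ≤ excess nu mu k} p →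
        kostkaFoulkes .C nu mu =
          ∑ k ∈ Finset.Icc p (Fin.last n), (-1 : ℤ[X]) ^ (n - k.val) *
            ∑ᶠ rm ∈ rowPairs (excess nu mu k), X ^ (rm.1 + rm.2) *
              (pieri .C (gammaWeight nu k) rm.1).sum fun lam c =>
                c • kostkaFoulkes .C lam (dropTop mu)) ∧
      ((∀ k : Fin (n + 1), excess nu mu k < 0) → kostkaFoulkes .C nu mu = 0)) ∧
    -- type D
    (2 ≤ n → IsDominant .D nu → IsDominant .D mu →
      (∀ p : Fin (n + 1), IsLeast {k | 0 ≤ excessD nu mu k} p →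
        kostkaFoulkes .D nu mu =
          ∑ k ∈ Finset.Icc p (Fin.last n), (-1 : ℤ[X]) ^ (n - k.val) *
            ∑ᶠ rm ∈ rowPairs (excessD nu mu k), X ^ (rm.1 + 2 * rm.2) *
              (pieri .D (gammaWeightD nu k) rm.1).sum fun lam d =>
                d • kostkaFoulkes .D lam (dropTop mu)) ∧
      ((∀ k : Fin (n + 1), excessD nu mu k < 0) → kostkaFoulkes .D nu mu = 0)) 
:= by
  refine ⟨fun hn hnu hmu => ?_, fun hn hnu hmu => ?_, fun hn hnu hmu => ?_⟩
  · exact sum_eq_sum_Icc_and_eq_zero (kostkaFoulkes_recurrence (by simp) hn hnu hmu)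
      fun k hk => by
        rw [rowPairs_eq_empty_of_neg hk, finsum_mem_empty, mul_zero]
  · exact sum_eq_sum_Icc_and_eq_zero (kostkaFoulkes_recurrence (by simp) hn hnu hmu)
      fun k hk => by
        rw [rowPairs_eq_empty_of_neg hk, finsum_mem_empty, mul_zero]
  · exact sum_eq_sum_Icc_and_eq_zero (kostkaFoulkes_recurrence_D hn hnu hmu)
      fun k hk => by
        rw [rowPairs_eq_empty_of_neg hk, finsum_mem_empty, mul_zero]
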